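/- There are a randomized word-RAM program $P$ and constants $c,k\in\mathbb N$, $C>0$ with the following property. Let $G=(V,E)$ be a directed or undirected unweighted graph with $n\ge 1$ vertices, $m$ edges and finite diameter $D=\max_{u,v\in V}d(u,v)$, where $d(u,v)$ is the least number of edges on a (directed) path from $u$ to $v$, and write $D=3h+z$ with integers $h\ge 0$ and $z\in\{0,1,2\}$. Let $G$ be given by $n$ and a list, in arbitrary order, of its arcs (for undirected $G$, each edge is listed in both orientations), and let the word size $w$ satisfy $w\ge c(\lfloor\log_2 n\rfloor+1)$. Then $P$ is a Las Vegas algorithm on $G$: its expected running time (number of machine steps) is at most $C\,(m+1)\sqrt n\,\log^k(n+1)$, that is, $\tilde O(m\sqrt n)$, so it halts almost surely, and whenever it halts, whatever its random choices were, it outputs an integer $\hat D$ with $$2h+z\le \hat D\le D\ \text{ if } z\in\{0,1\},\qquad 2h+1\le \hat D\le D\ \text{ if } z=2.$$ Here a program operates on registers and a memory of $w$-bit words, and each of the following takes one step: setting a register to a constant, addition, subtraction, multiplication, division with remainder (modulo $2^w$), reading or writing a memory cell whose address is in a register, drawing a uniformly random word, and control flow (sequencing, branching and while-loops on comparisons of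 registers). -/

import Mathlib

namespace DiamApprox

/-! ### Directed distances and the diameter -/

/-- There is a directed walk with exactly `k` arcs from `u` to `v`. -/
def HasWalk {V : Type*} (G : Digraph V) : ℕ → V → V → Prop
  | 0, u, v => u = v
  | k + 1, u, v => ∃ x, G.Adj u x ∧ HasWalk G k x v

/-- The distance from `u` to `v`: the least number of arcs on a directed walk from `u` to `v`,
and `⊤` if there is none. -/
noncomputable def edist {V : Type*} (G : Digraph V) (u v : V) : ℕ∞ :=
  ⨅ (k : ℕ) (_ : HasWalk G k u v), (k : ℕ∞)

/-- The diameter of a directed graph: the largest distance from a vertex to a vertex. -/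
noncomputable def ediam {V : Type*} (G : Digraph V) : ℕ∞ :=
  ⨆ (u : V) (v : V), edist G u v

/-! ### A randomized word RAM with a step count

Memory cells and registers hold words of `w` bits, that is natural numbers below `2 ^ w`.
A program refers to its (finitely many) registers by fixed numbers, and to memory cells
through addresses held in registers. -/

/-- Arithmetic on words. Results are reduced modulo `2 ^ w` when they are written. -/
inductive BinOp
  | add | sub | mul | div | mod

/-- Subtraction is truncated at `0`, division rounds down, `x / 0 = 0` and `x mod 0 = x`. -/
def BinOp.eval : BinOp → ℕ → ℕ → ℕ
  | .add, x, y => x + y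
  | .sub, x, y => x - y
  | .mul, x, y => x * y
  | .div, x, y => x / y
  | .mod, x, y => x % y

/-- Comparisons of the contents of two registers. -/
inductive Test
  | lt (a b : ℕ)
  | eq (a b : ℕ)

/-- Programs. Below, `r_i` is the content of register `i`. -/
inductive Cmd
  /-- do nothing -/
  | skip
  /-- `r_d := c` -/
  | const (d c : ℕ)
  /-- `r_d := r_a ∘ r_b` -/
  | op (o : BinOp) (d a b : ℕ)
  /-- `r_d := mem[r_a]` -/
  | load (d a : ℕ)
  /-- `mem[r_a] := r_b` -/
  | store (a b : ℕ)
  /-- `r_d :=` a uniformly random word, independent of all earlier ones -/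
  | rand (d : ℕ)
  /-- first `p`, then `q` -/
  | seq (p q : Cmd)
  /-- if the test holds then `p` else `q` -/
  | ite (b : Test) (p q : Cmd)
  /-- while the test holds do `p` -/
  | loop (b : Test) (p : Cmd)

/-- The contents of the registers and of the memory. -/
structure State where
  reg : ℕ → ℕ
  mem : ℕ → ℕ

/-- Write `x`, reduced to a word of `w` bits, into register `d`. -/
def State.setReg (w : ℕ) (s : State) (d x : ℕ) : State :=
  { s with reg := Function.update s.reg d (x % 2 ^ w) }

/-- Write `x`, reduced to a word of `w` bits, into the memory cell with address `a`. -/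
def State.setMem (w : ℕ) (s : State) (a x : ℕ) : State :=
  { s with mem := Function.update s.mem a (x % 2 ^ w) }

def Test.Holds (s : State) : Test → Prop
  | .lt a b => s.reg a < s.reg b
  | .eq a b => s.reg a = s.reg b

instance (s : State) (b : Test) : Decidable (b.Holds s) :=
  match b with
  | .lt a b => inferInstanceAs (Decidable (s.reg a < s.reg b))
  | .eq a b => inferInstanceAs (Decidable (s.reg a = s.reg b))

/-- A configuration: the stack of commands still to be executed (the first one is next), and
the state. The machine has halted when the stack is empty. -/
abbrev Config := List Cmd × State

/-- One step of the machine with word size `w`: the distribution of the next configuration.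
Only `rand` is random. A halted configuration does not change any more. -/
noncomputable def step (w : ℕ) : Config → PMF Config
  | ([], s) => PMF.pure ([], s)
  | (.skip :: K, s) => PMF.pure (K, s)
  | (.const d c :: K, s) => PMF.pure (K, s.setReg w d c)
  | (.op o d a b :: K, s) => PMF.pure (K, s.setReg w d (o.eval (s.reg a) (s.reg b)))
  | (.load d a :: K, s) => PMF.pure (K, s.setReg w d (s.mem (s.reg a)))
  | (.store a b :: K, s) => PMF.pure (K, s.setMem w (s.reg a) (s.reg b))
  | (.rand d :: K, s) =>
      (PMF.uniformOfFintype (Fin (2 ^ w))).map fun x => (K, s.setReg w d (x : ℕ))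
  | (.seq p q :: K, s) => PMF.pure (p :: q :: K, s)
  | (.ite b p q :: K, s) => PMF.pure (if b.Holds s then (p :: K, s) else (q :: K, s))
  | (.loop b p :: K, s) =>
      PMF.pure (if b.Holds s then (p :: .loop b p :: K, s) else (K, s))

/-- The distribution of the configuration after `t` steps of the program `P` started in `s`. -/
noncomputable def run (w : ℕ) (P : Cmd) (s : State) : ℕ → PMF Config
  | 0 => PMF.pure ([P], s)
  | t + 1 => (run w P s t).bind (step w)

/-- The expected running time. If `T` (possibly `∞`) is the number of steps until the machine
halts, then `T > t` exactly when it has not halted after `t` steps, and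
`𝔼 T = ∑ t, ℙ (T > t)`. In particular the machine halts almost surely if this is finite. -/
noncomputable def expectedTime (w : ℕ) (P : Cmd) (s : State) : ENNReal :=
  ∑' t : ℕ, (run w P s t).toOuterMeasure {c | c.1 ≠ []}

/-- `P`, started in `s`, is a Las Vegas algorithm: whenever it halts, whatever the random words
were, the output (the content of register `0`) is correct, and the expected number of steps is
at most `B`. -/
def IsLasVegas (w : ℕ) (P : Cmd) (s : State) (Correct : ℕ → Prop) (B : ℝ) : Prop :=
  (∀ (t : ℕ) (c : Config), c ∈ (run w P s t).support → c.1 = [] → Correct (c.2.reg 0)) ∧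
    expectedTime w P s ≤ ENNReal.ofReal B

/-! ### Graphs as inputs -/

/-- `l` lists every pair `(u, v)` with `Adj u v` exactly once, in any order. For an undirected
graph every edge is thus listed in both orientations, as in adjacency lists. -/
def IsArcList {n : ℕ} (Adj : Fin n → Fin n → Prop) (l : List (Fin n × Fin n)) : Prop :=
  l.Nodup ∧ ∀ u v, (u, v) ∈ l ↔ Adj u v

/-- The initial state: cell `0` holds the number `n` of vertices, cell `1` the length of the
list, cells `2 + 2 * i` and `3 + 2 * i` hold the tail and the head of the `i`-th arc, and all
other cells and all registers hold `0`. -/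
def inputState {n : ℕ} (l : List (Fin n × Fin n)) : State where
  reg := fun _ => 0
  mem := fun a =>
    if a = 0 then n
    else if a = 1 then l.length
    else match l[(a - 2) / 2]? with
      | none => 0
      | some e => if a % 2 = 0 then (e.1 : ℕ) else (e.2 : ℕ)

/-- The guarantee on an estimate `E` of a diameter `3 * h + z` with `z ∈ {0, 1, 2}`. -/
def GoodEstimate (h z E : ℕ) : Prop :=
  E ≤ 3 * h + z ∧ (z ≤ 1 → 2 * h + z ≤ E) ∧ (z = 2 → 2 * h + 1 ≤ E)

end DiamApprox

/-!
# Approximating the diameter of a graph in time `Õ(m √n)`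

*Algorithm.* Draw a sample `S` of `k = 4 r L` vertices, where `r ≈ √n` and `2 ^ L ≥ n`. A search of
the reversed graph from all of `S` at once yields `d(v, S)` for every `v`, and a vertex `c` with the
largest `d(c, S)`. Search forwards from every `s ∈ S` and from `c`, and backwards from every
vertex of the open ball `{x | d(c, x) < d(c, S)}`. The output is the largest distance seen.

*Correctness* (`goodEstimate_of_searches`) does not depend on the sample. Let `d(a, b) = 3 h + z`.
If `d(c, S) ≤ h`, then `d(a, s) ≤ h` for some `s ∈ S`, hence `d(s, b) ≥ 2 h + z`. Otherwise the ball
contains all vertices at distance at most `h` from `c`. If `d(c, b) < 2 h + z`, the vertex `x` at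
distance `h` from `c` on a shortest path to `b` has `d(x, b) < h + z`, so `d(a, x) ≥ 2 h + 1`, and
`x` is searched backwards.

*Running time.* Each search takes linear time (`wp_bfs`), so only the size of the ball has to be
bounded, in expectation. For every `v` fix the smallest ball `A v` around `v` with at least `r`
vertices (`exists_smallest_ball`). If the ball around `c` has `r` vertices or more, it contains `A c`,
and then `S` misses `A c` (`card_ball_le`). A fixed `A v` is missed with probability at most
`1 / n ^ 2` (`iavg_miss_le`), and there are only `n` of these sets, so the ball has at most `r + 1`
elements on average.

*The machine.* The program is written in a small deterministic language `Stm` of variables and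
arrays, except for the loop that draws the sample. The predicate transformer `wp` for this language
keeps a clock, loops being justified by invariants with a potential; `exists_steps_of_wp` transfers
it to the word RAM. `LasVegasFrom` and `Good` express correctness and expected running time from an
intermediate configuration. They are proved from the end of the program to its beginning, and
a random draw averages the bounds (`good_rand`, `good_drawSample`).
-/

namespace DiamApprox

/-! ### Runs of the machine -/

/-- The distribution of the configuration after `t` steps from an arbitrary configuration. -/
noncomputable def runFrom (w : ℕ) (c : Config) : ℕ → PMF Config
  | 0 => PMF.pure c
  | t + 1 => (runFrom w c t).bind (step w)

theorem run_eq_runFrom (w : ℕ) (P : Cmd) (s : State) (t : ℕ) :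
    run w P s t = runFrom w ([P], s) t := by
  induction t with
  | zero => rfl
  | succ t ih => simp only [run, runFrom, ih]

/-- The first step, rather than the last one, is split off. -/
theorem runFrom_succ (w : ℕ) (c : Config) (t : ℕ) :
    runFrom w c (t + 1) = (step w c).bind fun c' => runFrom w c' t := by
  induction t with
  | zero => simp [runFrom]
  | succ t ih =>
    rw [runFrom, ih, PMF.bind_bind]
    rfl

/-- The machine, started in configuration `c`, is a Las Vegas algorithm with expected number of
steps at most `B`. -/
def LasVegasFrom (w : ℕ) (Correct : ℕ → Prop) (c : Config) (B : ENNReal) : Prop :=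
  (∀ (t : ℕ) (c' : Config), c' ∈ (runFrom w c t).support → c'.1 = [] → Correct (c'.2.reg 0)) ∧
    ∑' t : ℕ, (runFrom w c t).toOuterMeasure {c | c.1 ≠ []} ≤ B

section LasVegas

variable {w : ℕ} {Correct : ℕ → Prop}

theorem runFrom_halted (s : State) (t : ℕ) : runFrom w ([], s) t = PMF.pure ([], s) := by
  induction t with
  | zero => rfl
  | succ t ih => simp [runFrom, ih, step]

theorem LasVegasFrom.halted {s : State} (hs : Correct (s.reg 0)) (B : ENNReal) :
    LasVegasFrom w Correct ([], s) B := by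
  constructor
  · intro t c' hc' _
    rw [runFrom_halted, PMF.mem_support_pure_iff] at hc'
    rw [hc']; exact hs
  · simp [runFrom_halted]

theorem LasVegasFrom.mono {c : Config} {B B' : ENNReal} (h : LasVegasFrom w Correct c B)
    (hB : B ≤ B') : LasVegasFrom w Correct c B' := ⟨h.1, h.2.trans hB⟩

/-- The expected number of steps left is one more than its average over the next
configuration. -/
theorem LasVegasFrom.of_step {ι : Type} [Fintype ι] {c : Config} (hc : c.1 ≠ []) (μ : PMF ι)
    (g : ι → Config) (hstep : step w c = μ.map g) {B : ι → ENNReal}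
    (h : ∀ i, LasVegasFrom w Correct (g i) (B i)) :
    LasVegasFrom w Correct c (1 + ∑ i, μ i * B i) := by
  have hbind : ∀ t, runFrom w c (t + 1) = μ.bind fun i => runFrom w (g i) t := by
    intro t
    rw [runFrom_succ, hstep, PMF.bind_map]
    rfl
  constructor
  · intro t c' hc' hn
    cases t with
    | zero =>
      rw [runFrom, PMF.mem_support_pure_iff] at hc'
      exact absurd (hc' ▸ hn) hc
    | succ t =>
      rw [hbind, PMF.mem_support_bind_iff] at hc'
      obtain ⟨i, -, hi⟩ := hc'
      exact (h i).1 t c' hi hn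
  -- The term for time `0` is the step being made; the other terms are averages over `μ`.
  · rw [tsum_eq_zero_add' ENNReal.summable]
    gcongr
    · rw [runFrom, PMF.toOuterMeasure_pure_apply]
      split_ifs <;> simp
    · simp only [hbind, PMF.toOuterMeasure_bind_apply]
      rw [ENNReal.tsum_comm, tsum_fintype]
      gcongr with i
      rw [ENNReal.tsum_mul_left]
      gcongr
      exact (h i).2

theorem LasVegasFrom.of_step_pure {c c' : Config} (hc : c.1 ≠ []) (hstep : step w c = PMF.pure c')
    {B : ENNReal} (h : LasVegasFrom w Correct c' B) : LasVegasFrom w Correct c (1 + B) := by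
  have := LasVegasFrom.of_step (ι := Unit) hc (PMF.pure ()) (fun _ => c')
    (by rw [PMF.pure_map, hstep]) (B := fun _ => B) (fun _ => h)
  simpa using this

end LasVegas

/-- `Steps w t c c'`: from `c` the machine makes `t` steps, none of them random, and is then in
`c'`. -/
def Steps (w : ℕ) : ℕ → Config → Config → Prop
  | 0, c, c' => c = c'
  | t + 1, c, c' => c.1 ≠ [] ∧ ∃ d, step w c = PMF.pure d ∧ Steps w t d c'

theorem Steps.trans {w t₁ t₂ : ℕ} {c₁ c₂ c₃ : Config} (h₁ : Steps w t₁ c₁ c₂)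
    (h₂ : Steps w t₂ c₂ c₃) : Steps w (t₁ + t₂) c₁ c₃ := by
  induction t₁ generalizing c₁ with
  | zero => cases h₁; simpa using h₂
  | succ t ih =>
    obtain ⟨hc, d, hd, h⟩ := h₁
    rw [Nat.add_right_comm]
    exact ⟨hc, d, hd, ih h⟩

theorem Steps.head {w t : ℕ} {p : Cmd} {K : List Cmd} {s : State} {d c' : Config}
    (hd : step w (p :: K, s) = PMF.pure d) (h : Steps w t d c') :
    Steps w (t + 1) (p :: K, s) c' :=
  ⟨by simp, d, hd, h⟩

theorem LasVegasFrom.of_steps {w : ℕ} {Correct : ℕ → Prop} {t : ℕ} {c c' : Config}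
    (hs : Steps w t c c') {B : ENNReal} (h : LasVegasFrom w Correct c' B) :
    LasVegasFrom w Correct c (t + B) := by
  induction t generalizing c with
  | zero => cases hs; simpa using h
  | succ t ih =>
    obtain ⟨hc, d, hd, hs⟩ := hs
    refine (LasVegasFrom.of_step_pure hc hd (ih hs)).mono ?_
    rw [← add_assoc]; push_cast; rw [add_comm 1 (t : ENNReal)]

/-! ### A language with variables and arrays -/

/-- Program variables; each is kept in a register. -/
inductive Var
  | nVerts | nArcs | one | zero | nSrc | idx | ptr | cur | nbr | curDist | nbrDist | tmp | qHead
  | qTail | pos | nLst | best | radius | center | vertex | root | lg | pow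
  deriving DecidableEq

/-- Program arrays; together they fill the memory after the input, interleaved. -/
inductive Arr
  | first | next | dist | queue | src | lst
  deriving DecidableEq

/-- The number of an array. -/
def Arr.idx : Arr → ℕ := Arr.ctorIdx

theorem Var.ctorIdx_injective : Function.Injective Var.ctorIdx := by
  intro a b h
  rw [← Var.ofNat_ctorIdx a, ← Var.ofNat_ctorIdx b]
  exact congrArg Var.ofNat h

theorem Arr.idx_injective : Function.Injective Arr.idx := by
  intro a b h
  rw [← Arr.ofNat_ctorIdx a, ← Arr.ofNat_ctorIdx b]
  exact congrArg Arr.ofNat h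

theorem Arr.idx_lt (A : Arr) : A.idx < 8 := by
  cases A <;> decide

/-- Comparisons of variables. -/
inductive Cond
  | lt (a b : Var)
  | eq (a b : Var)

/-- Deterministic programs over variables and arrays. The statement `arc d o i` sets `d` to the
tail (`o = 0`) or the head (`o = 1`) of the `i`-th arc of the input. -/
inductive Stm
  | const (d : Var) (c : ℕ)
  | op (o : BinOp) (d a b : Var)
  | read (d : Var) (A : Arr) (i : Var)
  | write (A : Arr) (i x : Var)
  | arc (d : Var) (o : ℕ) (i : Var)
  | skip
  | seq (p q : Stm)
  | ite (c : Cond) (p q : Stm)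
  | loop (c : Cond) (p : Stm)

/-- First `p`, then `q`. -/
infixr:60 " ;; " => Stm.seq

/-- The register of a variable; registers `0`, …, `3` are kept for other purposes. -/
def Var.reg (x : Var) : ℕ := x.ctorIdx + 4

/-- The comparison of the registers of two variables. -/
def Cond.compile : Cond → Test
  | .lt a b => .lt a.reg b.reg
  | .eq a b => .eq a.reg b.reg

/-- Put the address `b + 8 * i + A.idx` into register `1`, where `b` is in register `2`, then do
`last`. With this layout the arrays are disjoint, however large their indices are. -/
def addrCmd (A : Arr) (i : Var) (last : Cmd) : Cmd :=
  .seq (.const 1 8) <| .seq (.op .mul 1 1 i.reg) <| .seq (.op .add 1 1 2) <|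
    .seq (.const 3 A.idx) <| .seq (.op .add 1 1 3) last

/-- Translation to machine code. Registers `1` and `3` are scratch, register `2` holds the first
address after the input. -/
def Stm.compile : Stm → Cmd
  | .const d c => .const d.reg c
  | .op o d a b => .op o d.reg a.reg b.reg
  | .read d A i => addrCmd A i (.load d.reg 1)
  | .write A i x => addrCmd A i (.store 1 x.reg)
  | .arc d o i => .seq (.const 1 2) <| .seq (.op .mul 1 1 i.reg) <|
      .seq (.const 3 (2 + o)) <| .seq (.op .add 1 1 3) (.load d.reg 1)
  | .skip => .skip
  | .seq p q => .seq p.compile q.compile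
  | .ite c p q => .ite c.compile p.compile q.compile
  | .loop c p => .loop c.compile p.compile

/-- Values of the variables and the arrays, and a clock. -/
structure AState where
  v : Var → ℕ
  a : Arr → ℕ → ℕ
  time : ℕ

namespace AState

/-- Let the clock advance by `t`. -/
def tick (σ : AState) (t : ℕ) : AState := { σ with time := σ.time + t }

/-- Assign to a variable in time `t`. -/
def set (σ : AState) (d : Var) (x t : ℕ) : AState where
  v := Function.update σ.v d x
  a := σ.a
  time := σ.time + t

/-- Assign to an array cell in time `t`. -/
def put (σ : AState) (A : Arr) (i x t : ℕ) : AState where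
  v := σ.v
  a := Function.update σ.a A (Function.update (σ.a A) i x)
  time := σ.time + t

variable (σ : AState) (d e : Var) (A B : Arr) (i x t : ℕ)

@[simp] theorem tick_v : (σ.tick t).v = σ.v := rfl
@[simp] theorem tick_a : (σ.tick t).a = σ.a := rfl
@[simp] theorem tick_time : (σ.tick t).time = σ.time + t := rfl
@[simp] theorem set_v : (σ.set d x t).v e = if e = d then x else σ.v e := by
  simp [set, Function.update_apply]
@[simp] theorem set_a : (σ.set d x t).a = σ.a := rfl
@[simp] theorem set_time : (σ.set d x t).time = σ.time + t := rfl
@[simp] theorem put_v : (σ.put A i x t).v = σ.v := rfl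
@[simp] theorem put_a :
    (σ.put A i x t).a B = if B = A then Function.update (σ.a A) i x else σ.a B := by
  simp only [put, Function.update_apply]
@[simp] theorem put_time : (σ.put A i x t).time = σ.time + t := rfl

end AState

/-- The comparison of two variables is true in `σ`. -/
def Cond.Holds (σ : AState) : Cond → Prop
  | .lt a b => σ.v a < σ.v b
  | .eq a b => σ.v a = σ.v b

/-- The fixed data of a computation: the word size `w`, the first address `b` after the input, and
the contents `inp` of the cells below `b`, which are never written to. -/
structure Env where
  w : ℕ
  b : ℕ
  inp : ℕ → ℕ

/-- The end `o` (tail for `o = 0`, head for `o = 1`) of the arc `a`. -/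
def Env.arcEnd (E : Env) (o a : ℕ) : ℕ := E.inp (2 * a + (2 + o))

/-- The machine state `s` represents the variables and arrays of `σ`. -/
structure Rep (E : Env) (σ : AState) (s : State) : Prop where
  base : s.reg 2 = E.b
  var : ∀ x : Var, s.reg x.reg = σ.v x
  arr : ∀ (A : Arr) (i : ℕ), s.mem (E.b + 8 * i + A.idx) = σ.a A i
  inp : ∀ x < E.b, s.mem x = E.inp x
  reg_lt : ∀ r, s.reg r < 2 ^ E.w
  mem_lt : ∀ x, s.mem x < 2 ^ E.w

/-- Weakest preconditions with time. `wp E p Q σ` guarantees that `p`, started in `σ`, does not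
overflow, terminates in a state satisfying `Q`, and that the clock of that state accounts for all
machine steps made. A loop is justified by an invariant indexed by a potential, the number of
steps that are still granted to the loop. -/
def wp (E : Env) : Stm → (AState → Prop) → AState → Prop
  | .const d c, Q, σ => c < 2 ^ E.w ∧ Q (σ.set d c 1)
  | .op o d a b, Q, σ =>
      o.eval (σ.v a) (σ.v b) < 2 ^ E.w ∧ Q (σ.set d (o.eval (σ.v a) (σ.v b)) 1)
  | .read d A i, Q, σ => E.b + 8 * σ.v i + 8 < 2 ^ E.w ∧ Q (σ.set d (σ.a A (σ.v i)) 11)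
  | .write A i x, Q, σ => E.b + 8 * σ.v i + 8 < 2 ^ E.w ∧ Q (σ.put A (σ.v i) (σ.v x) 11)
  | .arc d o i, Q, σ => 2 * σ.v i + (2 + o) < E.b ∧ Q (σ.set d (E.arcEnd o (σ.v i)) 9)
  | .skip, Q, σ => Q (σ.tick 1)
  | .seq p q, Q, σ => wp E p (wp E q Q) (σ.tick 1)
  | .ite c p q, Q, σ =>
      (c.Holds σ → wp E p Q (σ.tick 1)) ∧ (¬ c.Holds σ → wp E q Q (σ.tick 1))
  | .loop c p, Q, σ => ∃ (Inv : ℕ → AState → Prop) (k : ℕ), Inv k σ ∧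
      (∀ k' σ', Inv k' σ' → c.Holds σ' →
        wp E p (fun σ'' => ∃ k'', Inv k'' σ'' ∧ σ''.time + k'' ≤ σ'.time + k') (σ'.tick 1)) ∧
      ∀ k' σ', Inv k' σ' → ¬ c.Holds σ' → σ'.time + k' ≤ σ.time + k → Q (σ'.tick 1)

/-! ### Correctness of the translation -/

section Compile

variable {E : Env}

theorem Var.reg_ne (x : Var) : x.reg ≠ 1 ∧ x.reg ≠ 2 ∧ x.reg ≠ 3 ∧ x.reg ≠ 0 := by
  simp only [Var.reg]; omega

theorem Rep.tick {σ : AState} {s : State} (h : Rep E σ s) (t : ℕ) : Rep E (σ.tick t) s :=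
  ⟨h.base, h.var, h.arr, h.inp, h.reg_lt, h.mem_lt⟩

theorem Rep.setVar {σ : AState} {s : State} (h : Rep E σ s) (d : Var) {x : ℕ} (t : ℕ)
    (hx : x < 2 ^ E.w) : Rep E (σ.set d x t) (s.setReg E.w d.reg x) where
  base := by
    have := d.reg_ne
    simp [State.setReg, h.base, this.2.1.symm]
  var y := by
    by_cases hy : y = d
    · simp [hy, State.setReg, Nat.mod_eq_of_lt hx]
    · have : y.reg ≠ d.reg := fun h' => hy (Var.ctorIdx_injective (Nat.add_right_cancel h'))
      simp [hy, State.setReg, this, h.var]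
  arr := h.arr
  inp := h.inp
  reg_lt r := by
    simp only [State.setReg, Function.update_apply]
    split_ifs
    · exact Nat.mod_lt _ (by positivity)
    · exact h.reg_lt r
  mem_lt := h.mem_lt

theorem Rep.setScratch {σ : AState} {s : State} (h : Rep E σ s) {d : ℕ} (x : ℕ)
    (hd : d = 1 ∨ d = 3 ∨ d = 0) : Rep E σ (s.setReg E.w d x) where
  base := by rcases hd with rfl | rfl | rfl <;> simp [State.setReg, h.base]
  var y := by
    have := y.reg_ne
    rcases hd with rfl | rfl | rfl <;> simp [State.setReg, this, h.var]
  arr := h.arr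
  inp := h.inp
  reg_lt r := by
    simp only [State.setReg, Function.update_apply]
    split_ifs
    · exact Nat.mod_lt _ (by positivity)
    · exact h.reg_lt r
  mem_lt := h.mem_lt

theorem Rep.setMem {σ : AState} {s : State} (h : Rep E σ s) (A : Arr) (i : ℕ) {x : ℕ} (t : ℕ)
    (hx : x < 2 ^ E.w) : Rep E (σ.put A i x t) (s.setMem E.w (E.b + 8 * i + A.idx) x) where
  base := h.base
  var := h.var
  arr B j := by
    have hA := A.idx_lt
    have hB := B.idx_lt
    simp only [State.setMem, Function.update_apply, AState.put_a, Nat.mod_eq_of_lt hx]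
    by_cases hBA : B = A
    · subst hBA
      by_cases hj : j = i
      · simp [hj]
      · have : ¬ (E.b + 8 * j + B.idx = E.b + 8 * i + B.idx) := by omega
        simp [hj, h.arr]
    · have h1 : B.idx ≠ A.idx := fun h' => hBA (Arr.idx_injective h')
      have : ¬ (E.b + 8 * j + B.idx = E.b + 8 * i + A.idx) := by omega
      simp [hBA, this, h.arr]
  inp y hy := by
    have : y ≠ E.b + 8 * i + A.idx := by omega
    simp [State.setMem, this, h.inp y hy]
  reg_lt := h.reg_lt
  mem_lt y := by
    simp only [State.setMem, Function.update_apply]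
    split_ifs
    · exact Nat.mod_lt _ (by positivity)
    · exact h.mem_lt y

/-- The address computation does not overflow and only changes scratch registers. -/
theorem Rep.addr {σ : AState} {s : State} (h : Rep E σ s) (A : Arr) (i : Var) (last : Cmd)
    (K : List Cmd) (hb : E.b + 8 * σ.v i + 8 < 2 ^ E.w) :
    ∃ s', Rep E σ s' ∧ s'.reg 1 = E.b + 8 * σ.v i + A.idx ∧
      Steps E.w 10 (addrCmd A i last :: K, s) (last :: K, s') := by
  have hA := A.idx_lt
  have hi := i.reg_ne
  have e8 : 8 % 2 ^ E.w = 8 := Nat.mod_eq_of_lt (by omega)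
  have e1 : 8 * σ.v i % 2 ^ E.w = 8 * σ.v i := Nat.mod_eq_of_lt (by omega)
  have e2 : (8 * σ.v i + E.b) % 2 ^ E.w = 8 * σ.v i + E.b := Nat.mod_eq_of_lt (by omega)
  have e3 : A.idx % 2 ^ E.w = A.idx := Nat.mod_eq_of_lt (by omega)
  have e4 : (8 * σ.v i + E.b + A.idx) % 2 ^ E.w = 8 * σ.v i + E.b + A.idx :=
    Nat.mod_eq_of_lt (by omega)
  refine ⟨_, ?_, ?_, .head rfl <| .head rfl <| .head rfl <| .head rfl <| .head rfl <| .head rfl <|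
    .head rfl <| .head rfl <| .head rfl <| .head rfl rfl⟩
  · exact ((((h.setScratch _ (by simp)).setScratch _ (by simp)).setScratch _ (by simp)).setScratch
      _ (by simp)).setScratch _ (by simp)
  · simp [State.setReg, BinOp.eval, hi, h.var, h.base, e8, e1, e2, e3, e4]
    omega

theorem Cond.compile_holds {σ : AState} {s : State} (h : Rep E σ s) (c : Cond) :
    c.compile.Holds s ↔ c.Holds σ := by
  cases c <;> simp [Cond.compile, Test.Holds, Cond.Holds, h.var]

/-- Soundness of `wp` for the compiled program. -/
theorem exists_steps_of_wp {p : Stm} {Q : AState → Prop} {σ : AState} {s : State}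
    (h : wp E p Q σ) (hs : Rep E σ s) (K : List Cmd) :
    ∃ t s' σ', Steps E.w t (p.compile :: K, s) (K, s') ∧ Rep E σ' s' ∧
      σ.time + t ≤ σ'.time ∧ Q σ' := by
  induction p generalizing Q σ s K with
  | const d c =>
    exact ⟨1, _, _, .head rfl rfl, hs.setVar d 1 h.1, le_rfl, h.2⟩
  | op o d a b =>
    refine ⟨1, _, _, .head rfl rfl, ?_, le_rfl, h.2⟩
    rw [hs.var, hs.var]
    exact hs.setVar d 1 h.1
  | read d A i =>
    obtain ⟨s', h', hr, hst⟩ := hs.addr A i (.load d.reg 1) K h.1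
    refine ⟨11, _, _, hst.trans (t₂ := 1) (.head rfl rfl), ?_, le_rfl, h.2⟩
    rw [hr, h'.arr]
    refine h'.setVar d 11 ?_
    rw [← h'.arr]; exact h'.mem_lt _
  | write A i x =>
    obtain ⟨s', h', hr, hst⟩ := hs.addr A i (.store 1 x.reg) K h.1
    refine ⟨11, _, _, hst.trans (t₂ := 1) (.head rfl rfl), ?_, le_rfl, h.2⟩
    rw [hr, h'.var]
    refine h'.setMem A _ 11 ?_
    rw [← h'.var]; exact h'.reg_lt _
  | arc d o i =>
    have hb : E.b < 2 ^ E.w := hs.base ▸ hs.reg_lt 2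
    have hi := i.reg_ne
    have h1 := h.1
    have e8 : 2 % 2 ^ E.w = 2 := Nat.mod_eq_of_lt (by omega)
    have e1 : 2 * σ.v i % 2 ^ E.w = 2 * σ.v i := Nat.mod_eq_of_lt (by omega)
    have e2 : (2 + o) % 2 ^ E.w = 2 + o := Nat.mod_eq_of_lt (by omega)
    have e4 : (2 * σ.v i + (2 + o)) % 2 ^ E.w = 2 * σ.v i + (2 + o) :=
      Nat.mod_eq_of_lt (by omega)
    refine ⟨9, _, _, .head rfl <| .head rfl <| .head rfl <| .head rfl <| .head rfl <|
      .head rfl <| .head rfl <| .head rfl <| .head rfl rfl, ?_, le_rfl, h.2⟩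
    have hs4 := (((hs.setScratch (d := 1) 2 (by simp)).setScratch (d := 1) (2 * σ.v i)
      (by simp)).setScratch (d := 3) (2 + o) (by simp)).setScratch (d := 1)
      (2 * σ.v i + (2 + o)) (by simp)
    have := hs4.setVar d (x := E.arcEnd o (σ.v i)) 9
      (by rw [Env.arcEnd, ← hs.inp _ h1]; exact hs.mem_lt _)
    convert this using 1
    simp [State.setReg, BinOp.eval, Env.arcEnd, hi, hs.var, e8, e1, e2, e4, hs.inp _ h1]
  | skip => exact ⟨1, _, _, .head rfl rfl, hs.tick 1, le_rfl, h⟩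
  | seq p q ihp ihq =>
    obtain ⟨t₁, s₁, σ₁, hst₁, hs₁, ht₁, h₁⟩ := ihp h (hs.tick 1) (q.compile :: K)
    obtain ⟨t₂, s₂, σ₂, hst₂, hs₂, ht₂, h₂⟩ := ihq h₁ hs₁ K
    refine ⟨t₁ + t₂ + 1, s₂, σ₂, .head rfl (hst₁.trans hst₂), hs₂, ?_, h₂⟩
    simp at ht₁; omega
  | ite c p q ihp ihq =>
    have hc := Cond.compile_holds hs c
    by_cases hb : c.Holds σ
    · obtain ⟨t, s', σ', hst, hs', ht, h'⟩ := ihp (h.1 hb) (hs.tick 1) K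
      refine ⟨t + 1, s', σ', .head (d := (p.compile :: K, s)) ?_ hst, hs', ?_, h'⟩
      · simp [Stm.compile, step, hc, hb]
      · simp at ht; omega
    · obtain ⟨t, s', σ', hst, hs', ht, h'⟩ := ihq (h.2 hb) (hs.tick 1) K
      refine ⟨t + 1, s', σ', .head (d := (q.compile :: K, s)) ?_ hst, hs', ?_, h'⟩
      · simp [Stm.compile, step, hc, hb]
      · simp at ht; omega
  | loop c p ih =>
    obtain ⟨Inv, k, h₀, h₁, h₂⟩ := h
    -- Each iteration advances the clock, hence lowers the potential.
    suffices H : ∀ k' σ' s', Inv k' σ' → σ'.time + k' ≤ σ.time + k → Rep E σ' s' →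
        ∃ t s'' σ'', Steps E.w t ((Stm.loop c p).compile :: K, s') (K, s'') ∧ Rep E σ'' s'' ∧
          σ'.time + t ≤ σ''.time ∧ Q σ'' from H k σ s h₀ le_rfl hs
    intro k'
    induction k' using Nat.strong_induction_on with
    | _ k' ihk =>
    intro σ' s' hI hle hs'
    have hc := Cond.compile_holds hs' c
    by_cases hb : c.Holds σ'
    · obtain ⟨t₁, s₁, σ₁, hst₁, hs₁, ht₁, k₁, hI₁, hle₁⟩ :=
        ih (h₁ k' σ' hI hb) (hs'.tick 1) ((Stm.loop c p).compile :: K)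
      simp only [AState.tick_time] at ht₁
      obtain ⟨t₂, s₂, σ₂, hst₂, hs₂, ht₂, hQ⟩ :=
        ihk k₁ (by omega) σ₁ s₁ hI₁ (by omega) hs₁
      refine ⟨t₁ + t₂ + 1, s₂, σ₂, .head
        (d := (p.compile :: (Stm.loop c p).compile :: K, s')) ?_ (hst₁.trans hst₂), hs₂, by omega,
        hQ⟩
      simp [Stm.compile, step, hc, hb]
    · refine ⟨1, s', _, .head (d := (K, s')) ?_ rfl, hs'.tick 1, le_rfl, h₂ k' σ' hI hb hle⟩
      simp [Stm.compile, step, hc, hb]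

end Compile


/-! ### Breadth-first search: the mathematical part -/

/-- The invariant of breadth-first search on the arcs `a < m` from `tl a` to `hd a`, with source
set `S`. Here `dist v` is `0` for a vertex that has not been reached, and a candidate for one
more than its distance otherwise; `q` is the queue, `t` its length, and the first `h` entries
have been processed. -/
structure QueueInv (n m : ℕ) (tl hd : ℕ → ℕ) (S : ℕ → Prop) (dist q : ℕ → ℕ) (t h : ℕ) : Prop where
  lt : ∀ i < t, q i < n
  marked : ∀ i < t, dist (q i) ≠ 0
  inj : ∀ i < t, ∀ j < t, q i = q j → i = j
  surj : ∀ v < n, dist v ≠ 0 → ∃ i < t, q i = v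
  sorted : ∀ i j, i ≤ j → j < t → dist (q i) ≤ dist (q j)
  width : ∀ j < t, h < t → dist (q j) ≤ dist (q h) + 1
  pred : ∀ v < n, dist v ≠ 0 → (dist v = 1 ∧ S v) ∨
    ∃ a < m, hd a = v ∧ dist (tl a) ≠ 0 ∧ dist v = dist (tl a) + 1
  done : ∀ i < h, ∀ a < m, tl a = q i → dist (hd a) ≠ 0 ∧ dist (hd a) ≤ dist (q i) + 1
  head_le : h ≤ t

namespace QueueInv

variable {n m : ℕ} {tl hd : ℕ → ℕ} {S : ℕ → Prop} {dist q : ℕ → ℕ} {t h : ℕ}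

theorem length_le (H : QueueInv n m tl hd S dist q t h) : t ≤ n := by
  have := Finset.card_le_card_of_injOn (s := Finset.range t) (t := Finset.range n) q
    (fun i hi => by simpa using H.lt i (by simpa using hi))
    (fun i hi j hj => H.inj i (by simpa using hi) j (by simpa using hj))
  simpa using this

theorem empty (hdist : ∀ v < n, dist v = 0) : QueueInv n m tl hd S dist q 0 0 := by
  constructor <;> grind

/-- A newly reached vertex is appended to the queue. -/
theorem push (H : QueueInv n m tl hd S dist q t h) {v c : ℕ} (hv : v < n)
    (h0 : dist v = 0) (hc : c ≠ 0) (hle : ∀ i < t, dist (q i) ≤ c) (hw : h < t → c ≤ dist (q h) + 1)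
    (hp : (c = 1 ∧ S v) ∨ ∃ a < m, hd a = v ∧ dist (tl a) ≠ 0 ∧ c = dist (tl a) + 1) :
    QueueInv n m tl hd S (Function.update dist v c) (Function.update q t v) (t + 1) h := by
  obtain ⟨h1, h2, h3, h4, h5, h6, h7, h8, h9⟩ := H
  have e1 : ∀ i < t, q i ≠ v := fun i hi e => h2 i hi (e ▸ h0)
  have e2 : ∀ i, Function.update q t v i = if i = t then v else q i := fun i =>
    Function.update_apply ..
  have e3 : ∀ i, Function.update dist v c i = if i = v then c else dist i := fun i =>
    Function.update_apply ..
  have e4 : ∀ i < t, Function.update dist v c (Function.update q t v i) = dist (q i) := by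
    intro i hi
    rw [e2, if_neg hi.ne, e3, if_neg (e1 i hi)]
  have e5 : Function.update dist v c (Function.update q t v t) = c := by simp
  have e6 : ∀ u, dist u ≠ 0 → Function.update dist v c u = dist u := by
    intro u hu
    rw [e3, if_neg]; rintro rfl; exact hu h0
  refine ⟨?_, ?_, ?_, ?_, ?_, ?_, ?_, ?_, by omega⟩
  · intro i hi; rw [e2]; split_ifs with h; exacts [hv, h1 i (by omega)]
  · intro i hi
    rcases Nat.lt_succ_iff_lt_or_eq.1 hi with hi | rfl
    · rw [e4 i hi]; exact h2 i hi
    · rwa [e5]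
  · intro i hi j hj hij
    rw [e2, e2] at hij
    split_ifs at hij with ha hb hb
    · omega
    · exact absurd hij.symm (e1 j (by omega))
    · exact absurd hij (e1 i (by omega))
    · exact h3 i (by omega) j (by omega) hij
  · intro u hu hd
    rw [e3] at hd
    by_cases huv : u = v
    · exact ⟨t, by omega, by simp [huv]⟩
    · rw [if_neg huv] at hd
      obtain ⟨i, hi, rfl⟩ := h4 u hu hd
      exact ⟨i, by omega, by rw [e2, if_neg hi.ne]⟩
  · intro i j hij hj
    rcases Nat.lt_succ_iff_lt_or_eq.1 hj with hj | rfl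
    · rw [e4 i (by omega), e4 j hj]; exact h5 i j hij hj
    · rw [e5]
      rcases hij.lt_or_eq with hi | rfl
      · rw [e4 i hi]; exact hle i hi
      · rw [e5]
  · intro j hj hh
    rcases Nat.lt_succ_iff_lt_or_eq.1 hh with hh | rfl
    · rw [e4 h hh]
      rcases Nat.lt_succ_iff_lt_or_eq.1 hj with hj | rfl
      · rw [e4 j hj]; exact h6 j hj hh
      · rw [e5]; exact hw hh
    · rw [e5]
      rcases Nat.lt_succ_iff_lt_or_eq.1 hj with hj | rfl
      · rw [e4 j hj]; exact (hle j hj).trans (Nat.le_succ c)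
      · rw [e5]; omega
  · intro u hu hd
    by_cases huv : u = v
    · subst huv
      rcases hp with ⟨rfl, hS⟩ | ⟨a, ha, hav, hat, hca⟩
      · exact .inl ⟨by simp, hS⟩
      · exact .inr ⟨a, ha, hav, by rw [e6 _ hat]; exact hat, by rw [e6 _ hat]; simpa using hca⟩
    · rw [e3, if_neg huv] at hd
      rw [e6 u hd]
      rcases h7 u hu hd with hS | ⟨a, ha, hav, hat, hca⟩
      · exact .inl hS
      · exact .inr ⟨a, ha, hav, by rw [e6 _ hat]; exact hat, by rw [e6 _ hat]; exact hca⟩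
  · intro i hi a ha hat
    have hit : i < t := by omega
    rw [e2, if_neg hit.ne] at hat
    rw [e4 i hit]
    obtain ⟨hm, hl⟩ := h8 i hi a ha hat
    rw [e6 _ hm]
    exact ⟨hm, hl⟩

/-- Distances do not exceed the number of vertices, hence do not overflow. -/
theorem dist_le (H : QueueInv n m tl hd S dist q t h) (htl : ∀ a < m, tl a < n) :
    ∀ i < t, dist (q i) ≤ i + 1 := by
  intro i
  induction i using Nat.strong_induction_on with
  | _ i ih =>
  intro hi
  rcases H.pred _ (H.lt i hi) (H.marked i hi) with ⟨h1, -⟩ | ⟨a, ha, -, hm, he⟩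
  · omega
  · obtain ⟨j, hj, hqj⟩ := H.surj _ (htl a ha) hm
    rw [← hqj] at he
    have hji : j < i := by
      by_contra hij
      have := H.sorted i j (by omega) hj
      omega
    have := ih j hji hj
    omega

/-- The first unprocessed vertex of the queue has been processed. -/
theorem pop (H : QueueInv n m tl hd S dist q t h) (hh : h < t)
    (hdone : ∀ a < m, tl a = q h → dist (hd a) ≠ 0 ∧ dist (hd a) ≤ dist (q h) + 1) :
    QueueInv n m tl hd S dist q t (h + 1) := by
  obtain ⟨h1, h2, h3, h4, h5, h6, h7, h8, h9⟩ := H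
  refine ⟨h1, h2, h3, h4, h5, ?_, h7, ?_, hh⟩
  · intro j hj hh'
    have := h6 j hj hh
    have := h5 h (h + 1) (by omega) hh'
    omega
  · intro i hi a ha hat
    rcases Nat.lt_succ_iff_lt_or_eq.1 hi with hi | rfl
    · exact h8 i hi a ha hat
    · exact hdone a ha hat

end QueueInv

/-- `d` is the distance from the set `S` in the graph with vertices `v < n` and arcs `a < m` from
`tl a` to `hd a`, all vertices being at finite distance: the local characterization. -/
structure IsDistFrom (n m : ℕ) (tl hd : ℕ → ℕ) (S : ℕ → Prop) (d : ℕ → ℕ) : Prop where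
  eq_zero_iff : ∀ v < n, d v = 0 ↔ S v
  le_succ : ∀ a < m, d (hd a) ≤ d (tl a) + 1
  pred : ∀ v < n, ∀ k, d v = k + 1 → ∃ a < m, hd a = v ∧ d (tl a) = k

/-- When the queue has been exhausted, breadth-first search has computed the distances. -/
theorem QueueInv.dist_eq {n m : ℕ} {tl hd : ℕ → ℕ} {S : ℕ → Prop} {dist q d : ℕ → ℕ} {t : ℕ}
    (H : QueueInv n m tl hd S dist q t t) (htl : ∀ a < m, tl a < n)
    (hS : ∀ v < n, S v → dist v = 1) (hd : IsDistFrom n m tl hd S d) :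
    ∀ v < n, dist v = d v + 1 := by
  -- Along a shortest path from `S`, every vertex has been processed before the next one is needed.
  have upper : ∀ k, ∀ v < n, d v = k → dist v ≠ 0 ∧ dist v ≤ k + 1 := by
    intro k
    induction k with
    | zero =>
      intro v hv hk
      have := hS v hv ((hd.eq_zero_iff v hv).1 hk)
      omega
    | succ k ih =>
      intro v hv hk
      obtain ⟨a, ha, rfl, hak⟩ := hd.pred v hv k hk
      obtain ⟨hm, hle⟩ := ih (tl a) (htl a ha) hak
      obtain ⟨i, hi, hqi⟩ := H.surj _ (htl a ha) hm
      obtain ⟨hm', hle'⟩ := H.done i hi a ha hqi.symm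
      rw [hqi] at hle'
      exact ⟨hm', by omega⟩
  -- Every entry of the table is the length of a path from `S`, followed backwards by `pred`.
  have lower : ∀ k, ∀ v < n, dist v = k + 1 → d v ≤ k := by
    intro k
    induction k with
    | zero =>
      intro v hv hk
      rcases H.pred v hv (by omega) with ⟨-, hs⟩ | ⟨a, ha, -, hm, he⟩
      · exact ((hd.eq_zero_iff v hv).2 hs).le
      · omega
    | succ k ih =>
      intro v hv hk
      rcases H.pred v hv (by omega) with ⟨-, hs⟩ | ⟨a, ha, rfl, hm, he⟩
      · rw [(hd.eq_zero_iff v hv).2 hs]; omega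
      · have := ih (tl a) (htl a ha) (by omega)
        have := hd.le_succ a ha
        omega
  intro v hv
  obtain ⟨hm, hle⟩ := upper _ v hv rfl
  have := lower (dist v - 1) v hv (by omega)
  omega

/-- `L` is the linked list that starts with the code `e`, where `0` codes the end and `a + 1`
codes the item `a`, which is followed by the item coded by `nx a`. -/
def IsChain (nx : ℕ → ℕ) : ℕ → List ℕ → Prop
  | e, [] => e = 0
  | e, a :: L => e = a + 1 ∧ IsChain nx (nx a) L

theorem IsChain.congr {nx nx' : ℕ → ℕ} {L : List ℕ} {e : ℕ} (h : IsChain nx e L)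
    (hL : ∀ a ∈ L, nx' a = nx a) : IsChain nx' e L := by
  induction L generalizing e with
  | nil => exact h
  | cons a L ih =>
    refine ⟨h.1, ?_⟩
    rw [hL a (by simp)]
    exact ih h.2 fun b hb => hL b (by simp [hb])

/-- The items below `k` with label `u`, the last one first. -/
def bucket (tl : ℕ → ℕ) (k u : ℕ) : List ℕ := ((List.range k).filter fun a => tl a = u).reverse

theorem mem_bucket {tl : ℕ → ℕ} {k u a : ℕ} : a ∈ bucket tl k u ↔ a < k ∧ tl a = u := by
  simp [bucket]

theorem bucket_succ (tl : ℕ → ℕ) (k u : ℕ) :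
    bucket tl (k + 1) u = if tl k = u then k :: bucket tl k u else bucket tl k u := by
  rw [bucket, List.range_succ, List.filter_append, List.reverse_append]
  by_cases h : tl k = u <;> simp [h, bucket]

theorem length_bucket (tl : ℕ → ℕ) (k u : ℕ) :
    (bucket tl k u).length = ((Finset.range k).filter fun a => tl a = u).card := by
  induction k with
  | zero => simp [bucket]
  | succ k ih =>
    rw [bucket_succ, Finset.range_add_one, Finset.filter_insert]
    split_ifs with h <;> simp [ih]


/-! ### Breadth-first search: the program -/

/-- Empty the adjacency lists and the table of distances. -/
def clearTables : Stm :=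
  .const .idx 0 ;; .loop (.lt .idx .nVerts)
    (.write .first .idx .zero ;; .write .dist .idx .zero ;; .op .add .idx .idx .one)

/-- Put every arc at the front of the linked list of its tail (for `o = 0`) or of its head (for
`o = 1`, which means searching the reversed graph). -/
def buildLists (o : ℕ) : Stm :=
  .const .idx 0 ;; .loop (.lt .idx .nArcs)
    (.arc .cur o .idx ;; .read .tmp .first .cur ;; .write .next .idx .tmp ;;
      .op .add .idx .idx .one ;; .write .first .cur .idx)

/-- Unless the vertex `nbr` has been reached before, give it the distance `d` and put it into the
queue. -/
def visit (d : Var) : Stm :=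
  .read .tmp .dist .nbr ;; .ite (.eq .tmp .zero)
    (.write .dist .nbr d ;; .write .queue .qTail .nbr ;; .op .add .qTail .qTail .one) .skip

/-- Reach the sources, which are listed in the array `src`. -/
def visitSources : Stm :=
  .const .idx 0 ;; .const .qTail 0 ;; .loop (.lt .idx .nSrc)
    (.read .nbr .src .idx ;; visit .one ;; .op .add .idx .idx .one)

/-- Reach the heads (tails for `o = 0`) of the arcs in the linked list with code `ptr`. -/
def scanList (o : ℕ) : Stm :=
  .loop (.lt .zero .ptr)
    (.op .sub .ptr .ptr .one ;; .arc .nbr o .ptr ;; visit .nbrDist ;; .read .ptr .next .ptr)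

/-- Process the queue. -/
def processQueue (o : ℕ) : Stm :=
  .const .qHead 0 ;; .loop (.lt .qHead .qTail)
    (.read .cur .queue .qHead ;; .read .curDist .dist .cur ;; .op .add .nbrDist .curDist .one ;;
      .read .ptr .first .cur ;; scanList o ;; .op .add .qHead .qHead .one)

/-- Breadth-first search from the vertices in the array `src`, in the graph for `o = 0` and in
the reversed graph for `o = 1`. At the end `dist` holds the distances, increased by one, and
`cur` is a vertex with the largest one, which is in `curDist`. -/
def bfs (o : ℕ) : Stm :=
  clearTables ;; buildLists o ;; visitSources ;; processQueue (1 - o)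

/-- The variables that breadth-first search changes. -/
def Var.isTemp : Var → Bool
  | .idx | .ptr | .cur | .nbr | .curDist | .nbrDist | .tmp | .qHead | .qTail => true
  | _ => false

/-- The arrays that breadth-first search changes. -/
def Arr.isTemp : Arr → Bool
  | .src | .lst => false
  | _ => true

@[simp] theorem Var.isTemp_eq_true : Var.idx.isTemp = true ∧ Var.ptr.isTemp = true ∧
    Var.cur.isTemp = true ∧ Var.nbr.isTemp = true ∧ Var.curDist.isTemp = true ∧
    Var.nbrDist.isTemp = true ∧ Var.tmp.isTemp = true ∧ Var.qHead.isTemp = true ∧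
    Var.qTail.isTemp = true := ⟨rfl, rfl, rfl, rfl, rfl, rfl, rfl, rfl, rfl⟩

@[simp] theorem Arr.isTemp_eq_true : Arr.first.isTemp = true ∧ Arr.next.isTemp = true ∧
    Arr.dist.isTemp = true ∧ Arr.queue.isTemp = true := ⟨rfl, rfl, rfl, rfl⟩

/-- The states `σ` and `σ'` agree outside the working storage of breadth-first search. -/
structure Frame (σ σ' : AState) : Prop where
  v : ∀ x : Var, x.isTemp = false → σ'.v x = σ.v x
  a : ∀ A : Arr, A.isTemp = false → σ'.a A = σ.a A

namespace Frame

variable {σ₁ σ₂ σ₃ : AState}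

@[simp] theorem refl (σ : AState) : Frame σ σ := ⟨fun _ _ => rfl, fun _ _ => rfl⟩

theorem trans (h : Frame σ₁ σ₂) (h' : Frame σ₂ σ₃) : Frame σ₁ σ₃ :=
  ⟨fun x hx => (h'.v x hx).trans (h.v x hx), fun A hA => (h'.a A hA).trans (h.a A hA)⟩

@[simp] theorem tick_iff {t : ℕ} : Frame σ₁ (σ₂.tick t) ↔ Frame σ₁ σ₂ :=
  ⟨fun h => ⟨h.v, h.a⟩, fun h => ⟨h.v, h.a⟩⟩

@[simp] theorem set_iff {d : Var} {x t : ℕ} (hd : d.isTemp = true) :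
    Frame σ₁ (σ₂.set d x t) ↔ Frame σ₁ σ₂ := by
  have : ∀ y : Var, y.isTemp = false → (σ₂.set d x t).v y = σ₂.v y := fun y hy => by
    rw [AState.set_v, if_neg (by rintro rfl; exact Bool.noConfusion (hy.symm.trans hd))]
  exact ⟨fun h => ⟨fun y hy => (this y hy).symm.trans (h.v y hy), h.a⟩,
    fun h => ⟨fun y hy => (this y hy).trans (h.v y hy), h.a⟩⟩

@[simp] theorem put_iff {A : Arr} {i x t : ℕ} (hA : A.isTemp = true) :
    Frame σ₁ (σ₂.put A i x t) ↔ Frame σ₁ σ₂ := by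
  have : ∀ B : Arr, B.isTemp = false → (σ₂.put A i x t).a B = σ₂.a B := fun B hB => by
    rw [AState.put_a, if_neg (by rintro rfl; exact Bool.noConfusion (hB.symm.trans hA))]
  exact ⟨fun h => ⟨h.v, fun B hB => (this B hB).symm.trans (h.a B hB)⟩,
    fun h => ⟨h.v, fun B hB => (this B hB).trans (h.a B hB)⟩⟩

end Frame

/-- The environment of a graph with `n` vertices and `m` arcs, in which array indices up to `lim`
can be used. -/
structure Env.Valid (E : Env) (n m lim : ℕ) : Prop where
  base : E.b = 2 * m + 2
  n_le : n ≤ lim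
  m_le : m ≤ lim
  lim_lt : E.b + 8 * lim + 16 < 2 ^ E.w
  arc_lt : ∀ a < m, ∀ o < 2, E.arcEnd o a < n

/-- The constants of a computation are in their variables. -/
structure HasConsts (n m : ℕ) (σ : AState) : Prop where
  nVerts : σ.v .nVerts = n
  nArcs : σ.v .nArcs = m
  one : σ.v .one = 1
  zero : σ.v .zero = 0

theorem HasConsts.frame {n m : ℕ} {σ σ' : AState} (h : HasConsts n m σ) (hF : Frame σ σ') :
    HasConsts n m σ' :=
  ⟨(hF.v _ rfl).trans h.1, (hF.v _ rfl).trans h.2, (hF.v _ rfl).trans h.3,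
    (hF.v _ rfl).trans h.4⟩

section Bfs

variable {E : Env} {n m lim : ℕ} {σ : AState} {Q : AState → Prop}

theorem wp_clearTables (hV : E.Valid n m lim) (hc : HasConsts n m σ)
    (hQ : ∀ σ', Frame σ σ' → (∀ v < n, σ'.a .first v = 0) → (∀ v < n, σ'.a .dist v = 0) →
      σ'.time ≤ σ.time + (40 * n + 10) → Q σ') : wp E clearTables Q σ := by
  have hlim := hV.lim_lt
  have hn := hV.n_le
  refine ⟨by omega, fun k σ' => Frame σ σ' ∧ k = 40 * (n - σ'.v .idx) ∧ σ'.v .idx ≤ n ∧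
    (∀ v < σ'.v .idx, σ'.a .first v = 0) ∧ ∀ v < σ'.v .idx, σ'.a .dist v = 0,
    40 * n, ?_, ?_, ?_⟩
  · simp
  · rintro k σ' ⟨hF, rfl, hi, hf, hd⟩ hlt
    obtain ⟨c1, c2, c3, c4⟩ := hc.frame hF
    simp only [Cond.Holds, c1] at hlt
    simp only [wp, BinOp.eval, AState.tick_v, AState.put_v, c3, c4, AState.tick_time,
      AState.set_time, AState.put_time]
    refine ⟨by omega, by omega, by omega, _, ⟨?_, rfl, ?_, ?_, ?_⟩, ?_⟩
    · simpa using hF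
    · simp; omega
    · simp [Function.update_apply]; grind
    · simp [Function.update_apply]; grind
    · simp; omega
  · rintro k σ' ⟨hF, rfl, hi, hf, hd⟩ hlt hle
    obtain ⟨c1, c2, c3, c4⟩ := hc.frame hF
    simp only [Cond.Holds, c1] at hlt
    have hin : σ'.v .idx = n := by omega
    rw [hin] at hf hd
    refine hQ _ (by simpa using hF) hf hd ?_
    simp at hle ⊢; omega

theorem wp_buildLists (hV : E.Valid n m lim) (hc : HasConsts n m σ) {o : ℕ} (ho : o < 2)
    (hf : ∀ v < n, σ.a .first v = 0)
    (hQ : ∀ σ', Frame σ σ' → σ'.a .dist = σ.a .dist →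
      (∀ v < n, IsChain (σ'.a .next) (σ'.a .first v) (bucket (E.arcEnd o) m v)) →
      σ'.time ≤ σ.time + (60 * m + 10) → Q σ') : wp E (buildLists o) Q σ := by
  have hlim := hV.lim_lt
  have hn := hV.n_le
  have hm := hV.m_le
  have hb := hV.base
  refine ⟨by omega, fun k σ' => Frame σ σ' ∧ k = 60 * (m - σ'.v .idx) ∧ σ'.v .idx ≤ m ∧
    σ'.a .dist = σ.a .dist ∧ ∀ v < n, IsChain (σ'.a .next) (σ'.a .first v)
      (bucket (E.arcEnd o) (σ'.v .idx) v), 60 * m, ?_, ?_, ?_⟩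
  · simpa [bucket, IsChain] using hf
  · rintro k σ' ⟨hF, rfl, hi, hd, hch⟩ hlt
    obtain ⟨c1, c2, c3, c4⟩ := hc.frame hF
    simp only [Cond.Holds, c2] at hlt
    have hcur := hV.arc_lt _ hlt o ho
    simp [wp, BinOp.eval, c3]
    refine ⟨by omega, by omega, by omega, by omega, by omega, ⟨hF, hlt, hd, fun v hv => ?_⟩,
      by omega⟩
    rw [bucket_succ]
    have hcg : IsChain (Function.update (σ'.a .next) (σ'.v .idx)
        (σ'.a .first (E.arcEnd o (σ'.v .idx)))) (σ'.a .first v)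
        (bucket (E.arcEnd o) (σ'.v .idx) v) := by
      refine (hch v hv).congr fun a ha => ?_
      have := (mem_bucket.1 ha).1
      rw [Function.update_of_ne (by omega)]
    by_cases hvc : E.arcEnd o (σ'.v .idx) = v
    · rw [if_pos hvc, ← hvc]
      simp only [IsChain, true_and, Function.update_self]
      rw [← hvc] at hcg
      exact hcg
    · rw [if_neg hvc, Function.update_of_ne fun h => hvc h.symm]
      exact hcg
  · rintro k σ' ⟨hF, rfl, hi, hd, hch⟩ hlt hle
    obtain ⟨c1, c2, c3, c4⟩ := hc.frame hF
    simp only [Cond.Holds, c2] at hlt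
    have hin : σ'.v .idx = m := by omega
    rw [hin] at hch
    refine hQ _ (by simpa using hF) (by simpa using hd) hch ?_
    simp at hle ⊢; omega

end Bfs


/-- From `σ` to `σ'` some vertices have been added to the queue. -/
structure Grow (σ σ' : AState) : Prop where
  v : ∀ x : Var, x ∉ [.tmp, .qTail, .nbr, .ptr, .idx] → σ'.v x = σ.v x
  a : ∀ A : Arr, A ≠ .dist → A ≠ .queue → σ'.a A = σ.a A
  dist : ∀ u, σ.a .dist u ≠ 0 → σ'.a .dist u = σ.a .dist u
  tail_le : σ.v .qTail ≤ σ'.v .qTail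
  queue : ∀ i < σ.v .qTail, σ'.a .queue i = σ.a .queue i

namespace Grow

variable {σ₁ σ₂ σ₃ : AState}

theorem refl (σ : AState) : Grow σ σ :=
  ⟨fun _ _ => rfl, fun _ _ _ => rfl, fun _ _ => rfl, le_rfl, fun _ _ => rfl⟩

theorem trans (h : Grow σ₁ σ₂) (h' : Grow σ₂ σ₃) : Grow σ₁ σ₃ where
  v x hx := (h'.v x hx).trans (h.v x hx)
  a A h₁ h₂ := (h'.a A h₁ h₂).trans (h.a A h₁ h₂)
  dist u hu := (h'.dist u (by rwa [h.dist u hu])).trans (h.dist u hu)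
  tail_le := h.tail_le.trans h'.tail_le
  queue i hi := (h'.queue i (hi.trans_le h.tail_le)).trans (h.queue i hi)

theorem frame (h : Grow σ₁ σ₂) : Frame σ₁ σ₂ where
  v x hx := h.v x (by rintro hx'; fin_cases hx' <;> cases hx)
  a A hA := h.a A (by rintro rfl; cases hA) (by rintro rfl; cases hA)

theorem tick (h : Grow σ₁ σ₂) (t : ℕ) : Grow σ₁ (σ₂.tick t) := ⟨h.1, h.2, h.3, h.4, h.5⟩

theorem set (h : Grow σ₁ σ₂) {d : Var} {x t : ℕ} (hd : d ∈ [.tmp, .nbr, .ptr, .idx]) :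
    Grow σ₁ (σ₂.set d x t) where
  v y hy := by
    rw [AState.set_v, if_neg, h.v y hy]
    rintro rfl
    simp at hd hy
    tauto
  a := h.a
  dist := h.dist
  tail_le := by
    rw [AState.set_v, if_neg]
    · exact h.tail_le
    · rintro rfl; simp at hd
  queue := h.queue

end Grow

section Bfs

variable {E : Env} {n m lim : ℕ} {σ : AState} {Q : AState → Prop} {tl hd : ℕ → ℕ} {S : ℕ → Prop}

/-- The invariant of breadth-first search for a state of the program. -/
abbrev StateInv (n m : ℕ) (tl hd : ℕ → ℕ) (S : ℕ → Prop) (h : ℕ) (σ : AState) : Prop :=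
  QueueInv n m tl hd S (σ.a .dist) (σ.a .queue) (σ.v .qTail) h

/-- The assumptions say that the vertex `nbr` may be appended to the queue with the distance `d`
unless it has been reached before. -/
theorem wp_visit (hV : E.Valid n m lim) (hc : HasConsts n m σ) {d : Var} {h : ℕ}
    (hdt : d ≠ .tmp) (hnbr : σ.v .nbr < n) (hq : StateInv n m tl hd S h σ)
    (hd0 : σ.v d ≠ 0) (hle : ∀ i < σ.v .qTail, σ.a .dist (σ.a .queue i) ≤ σ.v d)
    (hw : h < σ.v .qTail → σ.v d ≤ σ.a .dist (σ.a .queue h) + 1)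
    (hp : (σ.v d = 1 ∧ S (σ.v .nbr)) ∨
      ∃ a < m, hd a = σ.v .nbr ∧ σ.a .dist (tl a) ≠ 0 ∧ σ.v d = σ.a .dist (tl a) + 1)
    (hQ : ∀ σ', Grow σ σ' → σ'.v .idx = σ.v .idx → σ'.v .ptr = σ.v .ptr →
      StateInv n m tl hd S h σ' → σ'.a .dist (σ.v .nbr) ≠ 0 →
      (∀ i < σ'.v .qTail, σ'.a .dist (σ'.a .queue i) ≤ σ.v d) → σ'.a .dist (σ.v .nbr) ≤ σ.v d →
      σ'.time ≤ σ.time + 60 → Q σ') : wp E (visit d) Q σ := by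
  have hlim := hV.lim_lt
  have hn := hV.n_le
  obtain ⟨c1, c2, c3, c4⟩ := hc
  have htn := hq.length_le
  refine ⟨by simp; omega, fun hz => ?_, fun hz => ?_⟩
  · simp [Cond.Holds, c4] at hz
    have hq' := hq.push hnbr hz hd0 hle hw hp
    have hd1 : ∀ u, σ.a .dist u ≠ 0 →
        Function.update (σ.a .dist) (σ.v .nbr) (σ.v d) u = σ.a .dist u := by
      intro u hu
      rw [Function.update_of_ne]; rintro rfl; exact hu hz
    simp [wp, BinOp.eval, c3, hdt]
    refine ⟨by omega, by omega, by omega, hQ _ ⟨?_, ?_, ?_, ?_, ?_⟩ ?_ ?_ ?_ ?_ ?_ ?_ ?_⟩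
    · intro x hx
      simp at hx
      simp [hx]
    · intro A h1 h2
      simp [h1, h2]
    · simpa using hd1
    · simp
    · intro i hi
      simp [Function.update_of_ne hi.ne]
    · simp
    · simp
    · simpa [StateInv] using hq'
    · simpa using hd0
    · intro i hi
      simp at hi ⊢
      rcases hi.lt_or_eq with hi | rfl
      · rw [Function.update_of_ne hi.ne, hd1 _ (hq.marked i hi)]
        exact hle i hi
      · simp
    · simp
    · simp
  · simp [Cond.Holds, c4] at hz
    refine hQ _ ?_ ?_ ?_ ?_ ?_ ?_ ?_ ?_
    · exact ((((Grow.refl σ).tick 1).set (by simp)).tick 1).tick 1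
    · simp
    · simp
    · simpa [StateInv] using hq
    · simpa using hz
    · simpa using hle
    · obtain ⟨i, hi, hiq⟩ := hq.surj _ hnbr hz
      have := hle i hi
      rw [hiq] at this
      simpa using this
    · simp

theorem wp_visitSources (hV : E.Valid n m lim) (hc : HasConsts n m σ) (hks : σ.v .nSrc ≤ lim)
    (hsrc : ∀ i < σ.v .nSrc, σ.a .src i < n) (hd0 : ∀ v < n, σ.a .dist v = 0)
    (hQ : ∀ σ', Frame σ σ' → σ'.a .first = σ.a .first → σ'.a .next = σ.a .next →
      StateInv n m tl hd (fun v => ∃ i < σ.v .nSrc, σ.a .src i = v) 0 σ' →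
      (∀ i < σ.v .nSrc, σ'.a .dist (σ.a .src i) = 1) →
      σ'.time ≤ σ.time + (100 * σ.v .nSrc + 10) → Q σ') : wp E visitSources Q σ := by
  have hlim := hV.lim_lt
  refine ⟨by simp, ?_⟩
  refine ⟨by omega, fun k σ' => Frame σ σ' ∧ k = 100 * (σ.v .nSrc - σ'.v .idx) ∧
    σ'.v .idx ≤ σ.v .nSrc ∧ σ'.a .first = σ.a .first ∧ σ'.a .next = σ.a .next ∧
    StateInv n m tl hd (fun v => ∃ i < σ.v .nSrc, σ.a .src i = v) 0 σ' ∧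
    (∀ i < σ'.v .qTail, σ'.a .dist (σ'.a .queue i) ≤ 1) ∧
    (∀ i < σ'.v .idx, σ'.a .dist (σ.a .src i) = 1), 100 * σ.v .nSrc, ?_, ?_, ?_⟩
  · simpa [StateInv] using QueueInv.empty hd0
  · rintro k σ' ⟨hF, rfl, hi, hf, hx, hI, hle, hs⟩ hlt
    obtain ⟨c1, c2, c3, c4⟩ := id (hc.frame hF)
    have e1 : σ'.v .nSrc = σ.v .nSrc := hF.v _ rfl
    have e2 : σ'.a .src = σ.a .src := hF.a _ rfl
    simp only [Cond.Holds, e1] at hlt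
    refine ⟨by simp; omega, ?_⟩
    set σ₁ := ((((σ'.tick 1).tick 1).set .nbr
      (((σ'.tick 1).tick 1).a .src (((σ'.tick 1).tick 1).v .idx)) 11).tick 1) with hσ₁
    have hF₁ : Frame σ σ₁ := by simpa [hσ₁] using hF
    have hG₁ : Grow σ' σ₁ := ((((Grow.refl σ').tick 1).tick 1).set (by simp)).tick 1
    have hnbr : σ₁.v .nbr = σ.a .src (σ'.v .idx) := by simp [hσ₁, e2]
    have h1 : σ₁.v .one = 1 := by simp [hσ₁, c3]
    refine wp_visit (tl := tl) (hd := hd) (S := fun v => ∃ i < σ.v .nSrc, σ.a .src i = v) (h := 0)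
      hV (hc.frame hF₁) (by simp) (hnbr ▸ hsrc _ hlt) (by simpa [StateInv, hσ₁] using hI)
      (by omega) (by simpa [hσ₁, c3] using hle) (fun _ => by omega)
      (.inl ⟨h1, _, hlt, hnbr.symm⟩) ?_
    intro σ₂ hG g1 g2 hI₂ hm hle₂ hl ht
    have g1' : σ₂.v .idx = σ'.v .idx := by rw [g1]; simp [hσ₁]
    have h1' : σ₂.v .one = 1 := by rw [hG.v .one (by simp), h1]
    have ht' : σ₂.time ≤ σ'.time + 74 := by simp [hσ₁] at ht; omega
    have hd₂ : σ₂.a .dist (σ.a .src (σ'.v .idx)) = 1 := by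
      rw [hnbr] at hm hl; omega
    rw [h1] at hle₂
    have hG' := hG₁.trans hG
    simp [wp, BinOp.eval, h1', g1']
    refine ⟨by omega, ⟨hF.trans hG'.frame, hlt, ?_, ?_, ?_, hle₂, ?_⟩, by omega⟩
    · rw [hG'.a _ (by simp) (by simp), hf]
    · rw [hG'.a _ (by simp) (by simp), hx]
    · simpa [StateInv] using hI₂
    · intro i hi
      rcases hi.lt_or_eq with hi | rfl
      · rw [hG'.dist _ (by rw [hs i hi]; simp), hs i hi]
      · exact hd₂
  · rintro k σ' ⟨hF, rfl, hi, hf, hx, hI, hle, hs⟩ hlt hle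
    have e1 : σ'.v .nSrc = σ.v .nSrc := hF.v _ rfl
    simp only [Cond.Holds, e1] at hlt
    have hin : σ'.v .idx = σ.v .nSrc := by omega
    rw [hin] at hs
    refine hQ _ (by simpa using hF) (by simpa using hf) (by simpa using hx)
      (by simpa [StateInv] using hI) (by simpa using hs) ?_
    simp at hle ⊢; omega

/-- The vertex `queue h` has been processed after its linked list has been scanned. The time is
proportional to the length of the list. -/
theorem wp_scanList (hV : E.Valid n m lim) (hc : HasConsts n m σ) {o h : ℕ} (ho : o < 2)
    (hI : StateInv n m (E.arcEnd (1 - o)) (E.arcEnd o) S h σ) (hh : h < σ.v .qTail)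
    (hdn : σ.v .nbrDist = σ.a .dist (σ.a .queue h) + 1)
    (hch : IsChain (σ.a .next) (σ.v .ptr) (bucket (E.arcEnd (1 - o)) m (σ.a .queue h)))
    (hQ : ∀ σ', Grow σ σ' → StateInv n m (E.arcEnd (1 - o)) (E.arcEnd o) S (h + 1) σ' →
      σ'.time ≤ σ.time + (100 * (bucket (E.arcEnd (1 - o)) m (σ.a .queue h)).length + 1) →
      Q σ') : wp E (scanList o) Q σ := by
  have hlim := hV.lim_lt
  have hml := hV.m_le
  have hb := hV.base
  have hqm := hI.marked h hh
  -- `L` is the part of the list that is still to be scanned.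
  refine ⟨fun k σ' => ∃ L : List ℕ, Grow σ σ' ∧ k = 100 * L.length ∧
    IsChain (σ.a .next) (σ'.v .ptr) L ∧
    (∀ a ∈ L, a < m ∧ E.arcEnd (1 - o) a = σ.a .queue h) ∧
    StateInv n m (E.arcEnd (1 - o)) (E.arcEnd o) S h σ' ∧
    (∀ a < m, E.arcEnd (1 - o) a = σ.a .queue h → a ∈ L ∨
      σ'.a .dist (E.arcEnd o a) ≠ 0 ∧ σ'.a .dist (E.arcEnd o a) ≤ σ.v .nbrDist),
    _, ⟨_, Grow.refl σ, rfl, hch, fun a ha => mem_bucket.1 ha, hI,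
      fun a ha h' => .inl (mem_bucket.2 ⟨ha, h'⟩)⟩, ?_, ?_⟩
  · rintro k σ' ⟨L, hG, rfl, hL, hLm, hI', hdone⟩ hlt
    obtain ⟨c1, c2, c3, c4⟩ := id (hc.frame hG.frame)
    simp only [Cond.Holds, c4] at hlt
    obtain _ | ⟨a, L⟩ := L
    · have : σ'.v .ptr = 0 := hL
      omega
    obtain ⟨hpa, hL⟩ := hL
    obtain ⟨ham, hau⟩ := hLm a (by simp)
    have ea : σ'.v .ptr - 1 = a := by omega
    refine ⟨?_, ?_⟩
    · simp [BinOp.eval, c3]; omega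
    refine ⟨?_, ?_⟩
    · simp [BinOp.eval, c3]; omega
    simp only [BinOp.eval, AState.tick_v, AState.set_v, c3, ea, if_true]
    set σ₁ := ((((((σ'.tick 1).tick 1).set .ptr a 1).tick 1).set .nbr (E.arcEnd o a) 9).tick 1)
      with hσ₁
    have hG₁ : Grow σ' σ₁ :=
      ((((((Grow.refl σ').tick 1).tick 1).set (by simp)).tick 1).set (by simp)).tick 1
    have hG₁' := hG.trans hG₁
    have hnbr : σ₁.v .nbr = E.arcEnd o a := by simp [hσ₁]
    have hdn₁ : σ₁.v .nbrDist = σ.v .nbrDist := hG₁'.v _ (by simp)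
    have hdist₁ : σ₁.a .dist = σ'.a .dist := by simp [hσ₁]
    have hqueue₁ : σ₁.a .queue = σ'.a .queue := by simp [hσ₁]
    have htail₁ : σ₁.v .qTail = σ'.v .qTail := by simp [hσ₁]
    have hqh : σ'.a .queue h = σ.a .queue h := hG.queue h hh
    have hdu : σ'.a .dist (σ.a .queue h) = σ.a .dist (σ.a .queue h) := hG.dist _ hqm
    have hh' : h < σ'.v .qTail := hh.trans_le hG.tail_le
    refine wp_visit (tl := E.arcEnd (1 - o)) (hd := E.arcEnd o) (S := S) (h := h)
      hV (hc.frame hG₁'.frame) (by simp) (hnbr ▸ hV.arc_lt a ham o ho)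
      (by simpa [StateInv, hσ₁] using hI') (by omega) ?_ ?_ ?_ ?_
    · rw [hdn₁, hdist₁, hqueue₁, htail₁, hdn, ← hdu, ← hqh]
      exact fun j hj => hI'.width j hj hh'
    · rw [hdn₁, hdist₁, hqueue₁, hdn, hqh, hdu]
      exact fun _ => le_rfl
    · refine .inr ⟨a, ham, hnbr.symm, ?_⟩
      rw [hdn₁, hdist₁, hau, hdu]
      exact ⟨hqm, hdn⟩
    · intro σ₂ hG₂ g1 g2 hI₂ hm hle₂ hl ht
      have g2' : σ₂.v .ptr = a := by rw [g2]; simp [hσ₁]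
      have hG₂' := hG₁'.trans hG₂
      have enx : σ₂.a .next = σ.a .next := hG₂'.a _ (by simp) (by simp)
      have ht' : σ₂.time ≤ σ'.time + 80 := by simp [hσ₁] at ht; omega
      simp only [wp, g2', enx]
      refine ⟨by omega, _, ⟨L, hG₂'.set (by simp), rfl, by simpa using hL,
        fun b hb => hLm b (by simp [hb]), by simpa [StateInv] using hI₂, ?_⟩, ?_⟩
      · intro b hbm hbu
        simp only [AState.set_a]
        rcases hdone b hbm hbu with hbL | ⟨h1, h2⟩
        · rcases List.mem_cons.1 hbL with rfl | hbL
          · rw [hnbr] at hm hl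
            exact .inr ⟨hm, by omega⟩
          · exact .inl hbL
        · rw [(hG₁.trans hG₂).dist _ h1]
          exact .inr ⟨h1, h2⟩
      · simp; omega
  · rintro k σ' ⟨L, hG, rfl, hL, hLm, hI', hdone⟩ hlt hle
    obtain ⟨c1, c2, c3, c4⟩ := hc.frame hG.frame
    simp only [Cond.Holds, c4] at hlt
    obtain _ | ⟨a, L⟩ := L
    · refine hQ _ (hG.tick 1) ?_ ?_
      · refine QueueInv.pop hI' (hh.trans_le hG.tail_le) ?_
        rw [AState.tick_a, hG.queue h hh, hG.dist _ hqm, ← hdn]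
        intro a ha hau
        simpa using hdone a ha hau
      · simp at hle ⊢; omega
    · have := hL.1
      omega

/-- The potential of the arcs decreases by the number of arcs out of the processed vertex. -/
theorem card_arcs_step {m h : ℕ} {tl q : ℕ → ℕ} (hq : ∀ i < h, q i ≠ q h) :
    ((Finset.range m).filter fun a => ∀ i < h, tl a ≠ q i).card =
      ((Finset.range m).filter fun a => ∀ i < h + 1, tl a ≠ q i).card +
        (bucket tl m (q h)).length := by
  rw [length_bucket, ← Finset.card_union_of_disjoint]
  · congr 1
    ext a
    simp only [Finset.mem_filter, Finset.mem_range, Finset.mem_union]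
    constructor
    · rintro ⟨ha, h'⟩
      by_cases hah : tl a = q h
      · exact .inr ⟨ha, hah⟩
      · refine .inl ⟨ha, fun i hi => ?_⟩
        rcases Nat.lt_succ_iff_lt_or_eq.1 hi with hi | rfl
        exacts [h' i hi, hah]
    · rintro (⟨ha, h'⟩ | ⟨ha, h'⟩)
      · exact ⟨ha, fun i hi => h' i (by omega)⟩
      · exact ⟨ha, fun i hi => h' ▸ (hq i hi).symm⟩
  · rw [Finset.disjoint_filter]
    exact fun a _ h1 h2 => h1 h (by omega) h2

theorem wp_processQueue (hV : E.Valid n m lim) (hc : HasConsts n m σ) {o : ℕ} (ho : o < 2)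
    (hI : StateInv n m (E.arcEnd (1 - o)) (E.arcEnd o) S 0 σ)
    (hS : ∀ v < n, S v → σ.a .dist v = 1)
    (hch : ∀ v < n, IsChain (σ.a .next) (σ.a .first v) (bucket (E.arcEnd (1 - o)) m v))
    {d : ℕ → ℕ} (hd : IsDistFrom n m (E.arcEnd (1 - o)) (E.arcEnd o) S d) (hn : 0 < n)
    (hQ : ∀ σ', Frame σ σ' → (∀ v < n, σ'.a .dist v = d v + 1) → σ'.v .cur < n →
      σ'.v .curDist = d (σ'.v .cur) + 1 → (∀ v < n, d v ≤ d (σ'.v .cur)) →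
      σ'.v .curDist ≤ n → σ'.time ≤ σ.time + (100 * n + 100 * m + 10) → Q σ') : wp E (processQueue o) Q σ := by
  have hlim := hV.lim_lt
  have hnl := hV.n_le
  -- The potential counts the vertices that have not been processed and the arcs out of them.
  refine ⟨by omega, fun k σ' => Frame σ σ' ∧ σ'.a .first = σ.a .first ∧ σ'.a .next = σ.a .next ∧
    StateInv n m (E.arcEnd (1 - o)) (E.arcEnd o) S (σ'.v .qHead) σ' ∧
    (∀ v < n, S v → σ'.a .dist v = 1) ∧
    (0 < σ'.v .qHead → σ'.v .cur = σ'.a .queue (σ'.v .qHead - 1) ∧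
      σ'.v .curDist = σ'.a .dist (σ'.v .cur)) ∧
    k = 100 * (n - σ'.v .qHead) + 100 * ((Finset.range m).filter fun a => ∀ i < σ'.v .qHead,
      E.arcEnd (1 - o) a ≠ σ'.a .queue i).card, 100 * n + 100 * m, ?_, ?_, ?_⟩
  · simpa [StateInv] using ⟨hI, hS⟩
  · rintro k σ' ⟨hF, hf, hx, hI', hS', hcur, rfl⟩ hlt
    simp only [Cond.Holds] at hlt
    obtain ⟨c1, c2, c3, c4⟩ := id (hc.frame hF)
    have htn := hI'.length_le
    set u := σ'.a .queue (σ'.v .qHead) with hu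
    have hun : u < n := hI'.lt _ hlt
    have hdu : σ'.a .dist u ≤ n :=
      (hI'.dist_le (fun a ha => hV.arc_lt a ha _ (by omega)) _ hlt).trans (by omega)
    simp only [wp, BinOp.eval, AState.tick_v, AState.tick_a, AState.set_v, AState.set_a, ← hu, c3,
      hf, reduceCtorEq, if_true, if_false]
    refine ⟨by omega, by omega, by omega, by omega, ?_⟩
    set σ₁ := ((((((((((σ'.tick 1).tick 1).set .cur u 11).tick 1).set .curDist
      (σ'.a .dist u) 11).tick 1).set .nbrDist (σ'.a .dist u + 1) 1).tick 1).set .ptr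
      (σ.a .first u) 11).tick 1) with hσ₁
    have hF₁ : Frame σ σ₁ := by simpa [hσ₁] using hF
    have e1 : σ₁.v .qHead = σ'.v .qHead := by simp [hσ₁]
    have e2 : σ₁.a = σ'.a := by simp [hσ₁]
    have e3 : σ₁.v .qTail = σ'.v .qTail := by simp [hσ₁]
    have e4 : σ₁.v .cur = u := by simp [hσ₁]
    have e5 : σ₁.v .curDist = σ'.a .dist u := by simp [hσ₁]
    refine wp_scanList (S := S) (h := σ'.v .qHead) hV (hc.frame hF₁) ho
      (by simpa [StateInv, e2, e3] using hI') (by rw [e3]; exact hlt)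
      (by simp [hσ₁, hu]) ?_ ?_
    · rw [e2, ← hu, hx]
      simpa [hσ₁] using hch u hun
    · intro σ₂ hG hI₂ ht
      rw [e2, ← hu] at ht
      have g1 : σ₂.v .qHead = σ'.v .qHead := by rw [hG.v _ (by simp), e1]
      have g2 : σ₂.v .one = 1 := (hc.frame (hF₁.trans hG.frame)).one
      have g3 : σ₂.v .cur = u := by rw [hG.v _ (by simp), e4]
      have g4 : σ₂.v .curDist = σ'.a .dist u := by rw [hG.v _ (by simp), e5]
      have g5 : ∀ i < σ'.v .qTail, σ₂.a .queue i = σ'.a .queue i := by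
        rw [← e3, ← e2]; exact hG.queue
      have g6 : ∀ v, σ'.a .dist v ≠ 0 → σ₂.a .dist v = σ'.a .dist v := by
        rw [← e2]; exact hG.dist
      have hdu0 := hI'.marked _ hlt
      have hcard := card_arcs_step (m := m) (h := σ'.v .qHead) (tl := E.arcEnd (1 - o))
        (q := σ'.a .queue) (fun i hi he => by
          have := hI'.inj i (by omega) _ hlt he
          omega)
      rw [← hu] at hcard hdu0
      have hcard' : ((Finset.range m).filter fun a => ∀ i < σ'.v .qHead + 1,
          E.arcEnd (1 - o) a ≠ σ₂.a .queue i) = (Finset.range m).filter fun a =>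
            ∀ i < σ'.v .qHead + 1, E.arcEnd (1 - o) a ≠ σ'.a .queue i := by
        refine Finset.filter_congr fun a _ => forall₂_congr fun i hi => ?_
        rw [g5 i (by omega)]
      have ht' : σ₂.time ≤ σ'.time + 41 +
          (100 * (bucket (E.arcEnd (1 - o)) m u).length + 1) := by
        simp [hσ₁] at ht; omega
      simp only [g1, g2]
      refine ⟨by omega, _, ⟨?_, ?_, ?_, ?_, ?_, ?_, rfl⟩, ?_⟩
      · simpa using hF₁.trans hG.frame
      · simp [hG.a .first, e2, hf]
      · simp [hG.a .next, e2, hx]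
      · simpa [StateInv] using hI₂
      · intro v hv hSv
        have := hS' v hv hSv
        simpa [g6 v (by omega)] using this
      · simp [g3, g4, g5 _ hlt, g6 u hdu0, ← hu]
      · simp only [AState.set_time, hcard']
        omega
  · rintro k σ' ⟨hF, hf, hx, hI', hS', hcur, rfl⟩ hlt hle
    simp only [Cond.Holds] at hlt
    have hht := hI'.head_le
    have hht : σ'.v .qHead = σ'.v .qTail := by omega
    have hI'' := hI'
    rw [StateInv, hht] at hI''
    have hdist := hI''.dist_eq (fun a ha => hV.arc_lt a ha _ (by omega)) hS' hd
    -- The last vertex of the queue, which was processed last, is a farthest one.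
    have hpos : 0 < σ'.v .qTail := by
      obtain ⟨i, hi, -⟩ := hI'.surj 0 hn (by rw [hdist 0 hn]; omega)
      omega
    obtain ⟨hc1, hc2⟩ := hcur (by omega)
    rw [hht] at hc1
    have hcn : σ'.v .cur < n := by rw [hc1]; exact hI'.lt _ (by omega)
    refine hQ _ (by simpa using hF) (by simpa using hdist) (by simpa using hcn) ?_ ?_ ?_ ?_
    · simp only [AState.tick_v]
      rw [hc2, hdist _ hcn]
    · intro v hv
      obtain ⟨i, hi, rfl⟩ := hI'.surj v hv (by rw [hdist v hv]; omega)
      have h1 := hI'.sorted i (σ'.v .qTail - 1) (by omega) (by omega)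
      rw [← hc1, hdist _ hv, hdist _ hcn] at h1
      simpa using h1
    · have h1 := hI''.dist_le (fun a ha => hV.arc_lt a ha _ (by omega)) (σ'.v .qTail - 1) (by omega)
      have h2 := hI''.length_le
      rw [AState.tick_v, hc2, hc1]
      omega
    · simp at hle ⊢; omega

end Bfs


/-- Breadth-first search is correct and takes linear time. -/
theorem wp_bfs {E : Env} {n m lim : ℕ} {σ : AState} {Q : AState → Prop} (hV : E.Valid n m lim)
    (hc : HasConsts n m σ) {o : ℕ} (ho : o < 2) (hn : 0 < n) (hks : σ.v .nSrc ≤ lim)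
    (hsrc : ∀ i < σ.v .nSrc, σ.a .src i < n) {d : ℕ → ℕ}
    (hd : IsDistFrom n m (E.arcEnd o) (E.arcEnd (1 - o))
      (fun v => ∃ i < σ.v .nSrc, σ.a .src i = v) d)
    (hQ : ∀ σ', Frame σ σ' → (∀ v < n, σ'.a .dist v = d v + 1) → σ'.v .cur < n →
      σ'.v .curDist = d (σ'.v .cur) + 1 → (∀ v < n, d v ≤ d (σ'.v .cur)) →
      σ'.v .curDist ≤ n → σ'.time ≤ σ.time + 200 * (n + m + σ.v .nSrc + 1) → Q σ') : wp E (bfs o) Q σ := by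
  have ho' : 1 - (1 - o) = o := by omega
  have hT : ∀ {σ : AState}, Frame σ (σ.tick 1) := by simp
  refine wp_clearTables hV (hc.frame hT) fun σ₁ hF₁ hf hd₁ ht₁ => ?_
  replace hF₁ := (hT.trans hF₁).trans hT
  refine wp_buildLists hV (hc.frame hF₁) ho (by simpa using hf) fun σ₂ hF₂ hd₂ hch ht₂ => ?_
  replace hF₂ := (hF₁.trans hF₂).trans hT
  have e1 : (σ₂.tick 1).v .nSrc = σ.v .nSrc := hF₂.v _ rfl
  have e2 : (σ₂.tick 1).a .src = σ.a .src := hF₂.a _ rfl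
  refine wp_visitSources hV (hc.frame hF₂) (by rwa [e1]) (by rwa [e1, e2])
    (tl := E.arcEnd o) (hd := E.arcEnd (1 - o)) ?_ fun σ₃ hF₃ hf₃ hx₃ hI hs ht₃ => ?_
  · rw [AState.tick_a, hd₂]
    simpa using hd₁
  rw [e1, e2] at hI hs
  rw [e1] at ht₃
  replace hF₃ := hF₂.trans hF₃
  refine wp_processQueue hV (hc.frame hF₃) (o := 1 - o) (by omega)
    (S := fun v => ∃ i < σ.v .nSrc, σ.a .src i = v) (d := d)
    (by rwa [ho']) ?_ ?_ (by rwa [ho']) hn fun σ₄ hF₄ h1 h2 h3 h4 h5 ht₄ => ?_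
  · rintro v - ⟨i, hi, rfl⟩
    exact hs i hi
  · rw [ho', hf₃, hx₃]
    exact hch
  · refine hQ σ₄ (hF₃.trans hF₄) h1 h2 h3 h4 h5 ?_
    simp only [AState.tick_time] at ht₁ ht₂ ht₃ ht₄
    omega


/-! ### Eccentricities -/

/-- Search from the vertex `y` (in the reversed graph for `o = 1`), and let `best` be at least
one more than the largest distance found. -/
def updateBest (o : ℕ) (y : Var) : Stm :=
  .write .src .zero y ;; .op .add .nSrc .one .zero ;; bfs o ;;
    .ite (.lt .best .curDist) (.op .add .best .curDist .zero) .skip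

/-- Do so for all vertices listed in `lst`. -/
def updateBestAll (o : ℕ) : Stm :=
  .const .pos 0 ;; .loop (.lt .pos .nLst)
    (.read .vertex .lst .pos ;; updateBest o .vertex ;; .op .add .pos .pos .one)

/-- List the vertices with an entry below `radius` in the table of distances. -/
def listBall : Stm :=
  .const .pos 0 ;; .const .nLst 0 ;; .loop (.lt .pos .nVerts)
    (.read .vertex .dist .pos ;;
      .ite (.lt .vertex .radius) (.write .lst .nLst .pos ;; .op .add .nLst .nLst .one) .skip ;;
      .op .add .pos .pos .one)

/-- The deterministic part of the algorithm, for a sample that is listed in `src` and in `lst`. The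
vertex `center` has the largest distance to the sample, and `radius` is one more than that distance.
The search from `center` comes last among the forward searches, so that `listBall` finds its table
of distances. -/
def estimate : Stm :=
  .op .add .nSrc .nLst .zero ;; bfs 1 ;; .op .add .center .cur .zero ;;
    .op .add .radius .curDist .zero ;; .const .best 0 ;; updateBestAll 0 ;;
    updateBest 0 .center ;; listBall ;; updateBestAll 1

/-- The states agree on `lst` and on the variables outside `X` that breadth-first search does not
change. -/
structure FrameOff (X : List Var) (σ σ' : AState) : Prop where
  v : ∀ x : Var, x.isTemp = false → x ∉ X → σ'.v x = σ.v x
  lst : σ'.a .lst = σ.a .lst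

namespace FrameOff

variable {X Y : List Var} {σ₁ σ₂ σ₃ : AState}

theorem refl (X : List Var) (σ : AState) : FrameOff X σ σ := ⟨fun _ _ _ => rfl, rfl⟩

theorem trans (h : FrameOff X σ₁ σ₂) (h' : FrameOff X σ₂ σ₃) : FrameOff X σ₁ σ₃ :=
  ⟨fun x hx hX => (h'.v x hx hX).trans (h.v x hx hX), h'.lst.trans h.lst⟩

theorem mono (h : FrameOff X σ₁ σ₂) (hXY : ∀ x ∈ X, x ∈ Y) : FrameOff Y σ₁ σ₂ :=
  ⟨fun x hx hY => h.v x hx fun hX => hY (hXY x hX), h.lst⟩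

theorem of_frame (h : Frame σ₁ σ₂) : FrameOff X σ₁ σ₂ :=
  ⟨fun x hx _ => h.v x hx, h.a _ rfl⟩

theorem set (h : FrameOff X σ₁ σ₂) {d : Var} {x t : ℕ} (hd : d ∈ X) :
    FrameOff X σ₁ (σ₂.set d x t) := by
  refine ⟨fun y hy hX => ?_, h.lst⟩
  rw [AState.set_v, if_neg (by rintro rfl; exact hX hd), h.v y hy hX]

theorem tick (h : FrameOff X σ₁ σ₂) (t : ℕ) : FrameOff X σ₁ (σ₂.tick t) := ⟨h.1, h.2⟩

theorem hasConsts (h : FrameOff X σ₁ σ₂) {n m : ℕ} (hc : HasConsts n m σ₁)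
    (hX : ∀ x ∈ X, x ∉ [.nVerts, .nArcs, .one, .zero]) : HasConsts n m σ₂ :=
  ⟨(h.v _ rfl fun h' => hX _ h' (by simp)).trans hc.1,
    (h.v _ rfl fun h' => hX _ h' (by simp)).trans hc.2,
    (h.v _ rfl fun h' => hX _ h' (by simp)).trans hc.3,
    (h.v _ rfl fun h' => hX _ h' (by simp)).trans hc.4⟩

end FrameOff

section Ecc

variable {E : Env} {n m lim : ℕ} {σ : AState} {Q : AState → Prop} {Δ : ℕ}

/-- The new value of `best` is at least `d v + 1` for every `v`, and it does not exceed `Δ + 1`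
where `Δ` is the diameter. -/
theorem wp_updateBest (hV : E.Valid n m lim) (hc : HasConsts n m σ) {o : ℕ} (ho : o < 2)
    (hn : 0 < n) {y : Var} (hyn : σ.v y < n) {d : ℕ → ℕ}
    (hd : IsDistFrom n m (E.arcEnd o) (E.arcEnd (1 - o)) (fun v => v = σ.v y) d)
    (hΔ : ∀ v < n, d v ≤ Δ) (hb : σ.v .best ≤ Δ + 1)
    (hQ : ∀ σ', FrameOff [.nSrc, .best] σ σ' → σ.v .best ≤ σ'.v .best → σ'.v .best ≤ Δ + 1 →
      (∀ v < n, d v + 1 ≤ σ'.v .best) → (∀ v < n, σ'.a .dist v = d v + 1) →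
      σ'.time ≤ σ.time + 1000 * (n + m + 1) → Q σ') : wp E (updateBest o y) Q σ := by
  have hlim := hV.lim_lt
  have hnl := hV.n_le
  obtain ⟨c1, c2, c3, c4⟩ := hc
  simp only [updateBest, wp, BinOp.eval, AState.tick_v, AState.put_v, c3, c4]
  refine ⟨by omega, by omega, ?_⟩
  refine wp_bfs hV (σ := _) (d := d) ⟨?_, ?_, ?_, ?_⟩ ho hn ?_ ?_ ?_ ?_
  · simpa using c1
  · simpa using c2
  · simpa using c3
  · simpa using c4
  · simp; omega
  · simp; omega
  · simpa [eq_comm] using hd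
  intro σ' hF hdist hcn hcd hmax hcle ht
  have hFO : FrameOff [.nSrc, .best] σ σ' := by
    refine ⟨fun x hx hX => ?_, ?_⟩
    · rw [hF.v x hx]
      simp only [List.mem_cons, List.not_mem_nil, or_false, not_or] at hX
      simp [hX]
    · rw [hF.a _ rfl]; simp
  have e1 : σ'.v .zero = 0 := by rw [hFO.v _ rfl (by simp), c4]
  have e2 : σ'.v .best = σ.v .best := by rw [hF.v _ rfl]; simp
  simp at ht
  have hall : ∀ v < n, d v + 1 ≤ σ'.v .curDist := fun v hv => by
    rw [hcd]; exact Nat.succ_le_succ (hmax v hv)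
  simp only [Cond.Holds]
  refine ⟨fun hlt => ⟨?_, ?_⟩, fun hlt => ?_⟩
  · simp [e1]; omega
  · simp only [e1, Nat.add_zero] at hlt ⊢
    refine hQ _ ((hFO.tick 1).set (by simp)) ?_ ?_ ?_ ?_ ?_
    · simp; omega
    · have := hΔ _ hcn
      simp; omega
    · simpa using hall
    · simpa using hdist
    · simp; omega
  · refine hQ _ ((hFO.tick 1).tick 1) ?_ ?_ ?_ ?_ ?_
    · simp; omega
    · simp; omega
    · intro v hv
      have := hall v hv
      simp; omega
    · simpa using hdist
    · simp; omega

theorem wp_updateBestAll (hV : E.Valid n m lim) (hc : HasConsts n m σ) {o : ℕ} (ho : o < 2)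
    (hn : 0 < n) (hlst : ∀ i < σ.v .nLst, σ.a .lst i < n) (hk : σ.v .nLst ≤ lim)
    {d : ℕ → ℕ → ℕ}
    (hd : ∀ s < n, IsDistFrom n m (E.arcEnd o) (E.arcEnd (1 - o)) (fun v => v = s) (d s))
    (hΔ : ∀ s < n, ∀ v < n, d s v ≤ Δ) (hb : σ.v .best ≤ Δ + 1)
    (hQ : ∀ σ', FrameOff [.nSrc, .best, .pos, .vertex] σ σ' → σ.v .best ≤ σ'.v .best →
      σ'.v .best ≤ Δ + 1 → (∀ i < σ.v .nLst, ∀ v < n, d (σ.a .lst i) v + 1 ≤ σ'.v .best) →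
      σ'.time ≤ σ.time + (1100 * (n + m + 1) * σ.v .nLst + 10) → Q σ') :
    wp E (updateBestAll o) Q σ := by
  have hlim := hV.lim_lt
  have hnl := hV.n_le
  refine ⟨by simp, fun k σ' => FrameOff [.nSrc, .best, .pos, .vertex] σ σ' ∧
    σ.v .best ≤ σ'.v .best ∧ σ'.v .best ≤ Δ + 1 ∧ σ'.v .pos ≤ σ.v .nLst ∧
    (∀ i < σ'.v .pos, ∀ v < n, d (σ.a .lst i) v + 1 ≤ σ'.v .best) ∧
    k = 1100 * (n + m + 1) * (σ.v .nLst - σ'.v .pos), 1100 * (n + m + 1) * σ.v .nLst, ?_, ?_, ?_⟩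
  · refine ⟨((FrameOff.refl _ σ).tick 1).set (by simp), ?_⟩
    simpa using hb
  · rintro k σ' ⟨hF, hb1, hb2, hp, hall, rfl⟩ hlt
    have hc' := hF.hasConsts hc (by simp)
    have e1 : σ'.v .nLst = σ.v .nLst := hF.v _ rfl (by simp)
    simp only [Cond.Holds, e1] at hlt
    refine ⟨by simp; omega, ?_⟩
    set s := σ.a .lst (σ'.v .pos) with hs
    have hsn : s < n := hlst _ hlt
    simp only [AState.tick_v, AState.tick_a, hF.lst, ← hs]
    set σ₁ := ((((σ'.tick 1).tick 1).set .vertex s 11).tick 1) with hσ₁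
    have hF₁ : FrameOff [.nSrc, .best, .pos, .vertex] σ σ₁ :=
      (((hF.tick 1).tick 1).set (by simp)).tick 1
    refine wp_updateBest hV (hF₁.hasConsts hc (by simp)) ho hn (y := .vertex)
      (by simpa [hσ₁] using hsn) (d := d s) (by simpa [hσ₁] using hd s hsn) (hΔ s hsn)
      (by simpa [hσ₁] using hb2) fun σ₂ hF₂ h1 h2 h3 h4 ht => ?_
    have hF₂' := hF₁.trans (hF₂.mono (Y := [.nSrc, .best, .pos, .vertex]) (by simp))
    have g1 : σ₂.v .pos = σ'.v .pos := by rw [hF₂.v _ rfl (by simp)]; simp [hσ₁]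
    have g2 : σ₁.v .best = σ'.v .best := by simp [hσ₁]
    have g3 : σ₂.v .one = 1 := (hF₂'.hasConsts hc (by simp)).one
    have ht' : σ₂.time ≤ σ'.time + 14 + 1000 * (n + m + 1) := by
      simp [hσ₁] at ht; omega
    simp only [wp, BinOp.eval, g1, g3]
    refine ⟨by omega, _, ⟨hF₂'.set (by simp), ?_, ?_, ?_, ?_, rfl⟩, ?_⟩
    · simp; omega
    · simpa using h2
    · simp; omega
    · intro i hi v hv
      simp at hi ⊢
      rcases hi.lt_or_eq with hi | rfl
      · have := hall i hi v hv
        omega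
      · exact h3 v hv
    · obtain ⟨r, hr⟩ := Nat.exists_eq_add_of_lt hlt
      have e2 : σ.v .nLst - σ'.v .pos = r + 1 := by omega
      have e3 : σ.v .nLst - (σ'.v .pos + 1) = r := by omega
      simp [e2, e3, mul_add]; omega
  · rintro k σ' ⟨hF, hb1, hb2, hp, hall, rfl⟩ hlt hle
    have e1 : σ'.v .nLst = σ.v .nLst := hF.v _ rfl (by simp)
    simp only [Cond.Holds, e1] at hlt
    have hin : σ'.v .pos = σ.v .nLst := by omega
    rw [hin] at hall
    refine hQ _ (hF.tick 1) hb1 hb2 hall ?_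
    simp at hle ⊢; omega

theorem wp_listBall (hV : E.Valid n m lim) (hc : HasConsts n m σ)
    (hQ : ∀ σ', (∀ x, x.isTemp = false → x ∉ [.pos, .vertex, .nLst] → σ'.v x = σ.v x) →
      (∀ i < σ'.v .nLst, σ'.a .lst i < n) →
      (∀ v < n, σ.a .dist v < σ.v .radius → ∃ i < σ'.v .nLst, σ'.a .lst i = v) →
      σ'.v .nLst ≤ ((Finset.range n).filter fun v => σ.a .dist v < σ.v .radius).card →
      σ'.time ≤ σ.time + (100 * n + 10) → Q σ') : wp E listBall Q σ := by
  have hlim := hV.lim_lt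
  have hnl := hV.n_le
  refine ⟨by simp, by simp, fun k σ' =>
    (∀ x, x.isTemp = false → x ∉ [.pos, .vertex, .nLst] → σ'.v x = σ.v x) ∧
    σ'.a .dist = σ.a .dist ∧ σ'.v .pos ≤ n ∧ (∀ i < σ'.v .nLst, σ'.a .lst i < n) ∧
    (∀ v < σ'.v .pos, σ.a .dist v < σ.v .radius → ∃ i < σ'.v .nLst, σ'.a .lst i = v) ∧
    σ'.v .nLst = ((Finset.range (σ'.v .pos)).filter fun v => σ.a .dist v < σ.v .radius).card ∧
    k = 100 * (n - σ'.v .pos), 100 * n, ?_, ?_, ?_⟩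
  · refine ⟨fun x hx hX => ?_, by simp⟩
    simp only [List.mem_cons, List.not_mem_nil, or_false, not_or] at hX
    simp [hX]
  · rintro k σ' ⟨hF, hd, hp, hl, hex, hcard, rfl⟩ hlt
    have e1 : σ'.v .nVerts = n := (hF _ rfl (by simp)).trans hc.1
    have e2 : σ'.v .one = 1 := (hF _ rfl (by simp)).trans hc.3
    have e3 : σ'.v .radius = σ.v .radius := hF _ rfl (by simp)
    simp only [Cond.Holds, e1] at hlt
    have hln : σ'.v .nLst ≤ n := by
      rw [hcard]
      refine (Finset.card_filter_le _ _).trans ?_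
      simpa using hp
    have hcs : ((Finset.range (σ'.v .pos + 1)).filter
        fun v => σ.a .dist v < σ.v .radius).card =
        σ'.v .nLst + if σ.a .dist (σ'.v .pos) < σ.v .radius then 1 else 0 := by
      rw [hcard, Finset.range_add_one, Finset.filter_insert]
      split_ifs <;> simp
    refine ⟨by simp; omega, fun hb => ?_, fun hb => ?_⟩
    · simp [Cond.Holds, hd, e3] at hb
      simp [wp, BinOp.eval, e2, hd, hcs, hb]
      refine ⟨by omega, by omega, by omega, ⟨fun x hx h1 h2 h3 => ?_, by omega, ?_, ?_⟩, by omega⟩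
      · simpa [h1, h2, h3] using hF x hx (by simp [h1, h2, h3])
      · intro i hi
        rcases hi.lt_or_eq with hi | rfl
        · rw [Function.update_of_ne hi.ne]; exact hl i hi
        · simpa using hlt
      · intro v hv hvr
        rcases hv.lt_or_eq with hv | rfl
        · obtain ⟨i, hi, rfl⟩ := hex v hv hvr
          exact ⟨i, by omega, by rw [Function.update_of_ne hi.ne]⟩
        · exact ⟨_, le_rfl, by simp⟩
    · simp [Cond.Holds, hd, e3] at hb
      simp [wp, BinOp.eval, e2, hd, hcs, hb.not_gt]
      refine ⟨by omega, ⟨fun x hx h1 h2 h3 => ?_, by omega, hl, ?_⟩, by omega⟩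
      · simpa [h1, h2, h3] using hF x hx (by simp [h1, h2, h3])
      · intro v hv hvr
        rcases hv.lt_or_eq with hv | rfl
        · exact hex v hv hvr
        · omega
  · rintro k σ' ⟨hF, hd, hp, hl, hex, hcard, rfl⟩ hlt hle
    have e1 : σ'.v .nVerts = n := (hF _ rfl (by simp)).trans hc.1
    simp only [Cond.Holds, e1] at hlt
    have hin : σ'.v .pos = n := by omega
    rw [hin] at hex hcard
    refine hQ _ hF hl hex hcard.le ?_
    simp at hle ⊢; omega

/-- The deterministic part of the algorithm. The bound on the running time contains the number of
vertices that are closer to `center` than the sample is. -/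
theorem wp_estimate (hV : E.Valid n m lim) (hc : HasConsts n m σ) (hn : 0 < n)
    (hlst : ∀ i < σ.v .nLst, σ.a .lst i < n) (hk : σ.v .nLst ≤ lim)
    (hsrc : ∀ i < σ.v .nLst, σ.a .src i = σ.a .lst i) {D : ℕ → ℕ → ℕ} {dS : ℕ → ℕ}
    (hout : ∀ s < n, IsDistFrom n m (E.arcEnd 0) (E.arcEnd 1) (fun v => v = s) (D s))
    (hin : ∀ s < n, IsDistFrom n m (E.arcEnd 1) (E.arcEnd 0) (fun v => v = s) fun v => D v s)
    (hS : IsDistFrom n m (E.arcEnd 1) (E.arcEnd 0)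
      (fun v => ∃ i < σ.v .nLst, σ.a .lst i = v) dS)
    (hΔ : ∀ s < n, ∀ v < n, D s v ≤ Δ)
    (hQ : ∀ σ' c, HasConsts n m σ' → c < n → (∀ v < n, dS v ≤ dS c) → σ'.v .best ≤ Δ + 1 →
      (∀ i < σ.v .nLst, ∀ v < n, D (σ.a .lst i) v + 1 ≤ σ'.v .best) →
      (∀ v < n, D c v + 1 ≤ σ'.v .best) →
      (∀ x < n, D c x < dS c → ∀ v < n, D v x + 1 ≤ σ'.v .best) →
      σ'.time ≤ σ.time + 2000 * (n + m + 1) * (σ.v .nLst +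
        ((Finset.range n).filter fun x => D c x < dS c).card + 1) → Q σ') :
    wp E estimate Q σ := by
  have hlim := hV.lim_lt
  have hnl := hV.n_le
  have hz := hc.zero
  simp only [estimate, wp, BinOp.eval, AState.tick_v, hz, Nat.add_zero]
  refine ⟨by omega, ?_⟩
  set σ₁ := (((σ.tick 1).set .nSrc (σ.v .nLst) 1).tick 1) with hσ₁
  have hF₁ : FrameOff [.nSrc] σ σ₁ := (((FrameOff.refl _ σ).tick 1).set (by simp)).tick 1
  have e1 : σ₁.v .nSrc = σ.v .nLst := by simp [hσ₁]
  have e2 : σ₁.a .src = σ.a .src := by simp [hσ₁]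
  have e3 : (fun v => ∃ i < σ.v .nLst, σ.a .src i = v) =
      fun v => ∃ i < σ.v .nLst, σ.a .lst i = v := by
    ext v
    refine exists_congr fun i => and_congr_right fun hi => ?_
    rw [hsrc i hi]
  refine wp_bfs hV (hF₁.hasConsts hc (by simp)) (o := 1) (by norm_num) hn (by rwa [e1])
    (by rw [e1, e2]; exact fun i hi => hsrc i hi ▸ hlst i hi) (d := dS)
    (by rw [e1, e2, e3]; exact hS) fun σ₂ hF₂ h1 hcn hcd hmax hcle ht₂ => ?_
  set c := σ₂.v .cur with hcdef
  have hF₂' := hF₁.trans (FrameOff.of_frame hF₂)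
  have z₂ := (hF₂'.hasConsts hc (by simp)).zero
  have n₂ : σ₂.v .nLst = σ.v .nLst := hF₂'.v _ rfl (by simp)
  simp only [z₂, Nat.add_zero, AState.set_v, AState.tick_v, reduceCtorEq, if_false]
  refine ⟨by omega, by omega, by omega, ?_⟩
  set σ₃ := ((((((σ₂.tick 1).set .center c 1).tick 1).set .radius (σ₂.v .curDist) 1).tick
    1).set .best 0 1).tick 1 with hσ₃
  have hF₃ : FrameOff [.nSrc, .center, .radius, .best] σ σ₃ :=
    (((((((hF₂'.mono (by simp)).tick 1).set (by simp)).tick 1).set (by simp)).tick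
      1).set (by simp)).tick 1
  have n₃ : σ₃.v .nLst = σ.v .nLst := hF₃.v _ rfl (by simp)
  have ct₃ : σ₃.v .center = c := by simp [hσ₃]
  have r₃ : σ₃.v .radius = σ₂.v .curDist := by simp [hσ₃]
  have ht₃ : σ₃.time = σ₂.time + 7 := by simp [hσ₃]
  have hc₃ := hF₃.hasConsts hc (by simp)
  refine wp_updateBestAll hV hc₃ (o := 0) (by norm_num) hn
    (by rw [n₃, hF₃.lst]; exact hlst) (by rwa [n₃]) (d := D) hout hΔ (by simp [hσ₃])
    fun σ₄ hF₄ _ hb₄ hall₄ ht₄ => ?_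
  rw [n₃, hF₃.lst] at hall₄
  rw [n₃] at ht₄
  have hc₄ := hF₄.hasConsts hc₃ (by simp)
  have ct₄ : (σ₄.tick 1).v .center = c := (hF₄.v _ rfl (by simp)).trans ct₃
  have r₄ : σ₄.v .radius = σ₂.v .curDist := (hF₄.v _ rfl (by simp)).trans r₃
  refine wp_updateBest (σ := σ₄.tick 1) hV ⟨hc₄.1, hc₄.2, hc₄.3, hc₄.4⟩ (o := 0) (by norm_num) hn
    (y := .center) (by rwa [ct₄]) (d := D c) (by rw [ct₄]; exact hout c hcn) (hΔ c hcn) hb₄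
    fun σ₅ hF₅ hle₅ hb₅ hall₅ hdist₅ ht₅ => ?_
  have hF₅' : FrameOff [.nSrc, .best] σ₄ σ₅ := (((FrameOff.refl _ σ₄).tick 1).trans hF₅)
  have hc₅ := hF₅'.hasConsts hc₄ (by simp)
  have r₅ : (σ₅.tick 1).v .radius = dS c + 1 := by
    rw [← hcd, ← r₄]; exact hF₅'.v _ rfl (by simp)
  refine wp_listBall hV ⟨hc₅.1, hc₅.2, hc₅.3, hc₅.4⟩ fun σ₆ hv₆ hl₆ hex₆ hcard₆ ht₆ => ?_
  have hset : ((Finset.range n).filter fun v => (σ₅.tick 1).a .dist v < (σ₅.tick 1).v .radius) =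
      (Finset.range n).filter fun x => D c x < dS c := by
    refine Finset.filter_congr fun x hx => ?_
    rw [r₅, AState.tick_a, hdist₅ x (Finset.mem_range.1 hx)]
    omega
  rw [hset] at hcard₆
  have hc₆ : HasConsts n m σ₆ := ⟨(hv₆ _ rfl (by simp)).trans hc₅.1,
    (hv₆ _ rfl (by simp)).trans hc₅.2, (hv₆ _ rfl (by simp)).trans hc₅.3,
    (hv₆ _ rfl (by simp)).trans hc₅.4⟩
  have b₆ : σ₆.v .best = σ₅.v .best := hv₆ _ rfl (by simp)
  have hcard_le : ((Finset.range n).filter fun x => D c x < dS c).card ≤ n :=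
    (Finset.card_filter_le _ _).trans (by simp)
  refine wp_updateBestAll hV hc₆ (o := 1) (by norm_num) hn hl₆ (by omega)
    (d := fun s v => D v s) hin (fun s hs v hv => hΔ v hv s hs) (by omega)
    fun σ₇ hF₇ hle₇ hb₇ hall₇ ht₇ => ?_
  refine hQ σ₇ c (hF₇.hasConsts hc₆ (by simp)) hcn hmax hb₇ ?_ ?_ ?_ ?_
  · intro i hi v hv
    have := hall₄ i hi v hv
    have : σ₄.v .best ≤ σ₅.v .best := hle₅
    omega
  · intro v hv
    have := hall₅ v hv
    omega
  · intro x hx hxr v hv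
    obtain ⟨i, hi, hix⟩ := hex₆ x hx (by rw [r₅, AState.tick_a, hdist₅ x hx]; omega)
    have := hall₇ i hi v hv
    rwa [hix] at this
  · rw [e1] at ht₂
    have hT : σ₁.time = σ.time + 3 := by simp [hσ₁]
    simp only [AState.tick_time] at ht₅ ht₆
    set k := σ.v .nLst
    set B := ((Finset.range n).filter fun x => D c x < dS c).card
    have h7 : 1100 * (n + m + 1) * σ₆.v .nLst ≤ 1100 * (n + m + 1) * B :=
      Nat.mul_le_mul_left _ hcard₆
    have h8 : 2000 * (n + m + 1) * (k + B + 1) = 2000 * (n + m + 1) * k +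
      2000 * (n + m + 1) * B + 2000 * (n + m + 1) := by ring
    have h9 : 900 * (1 * k) ≤ 900 * ((n + m + 1) * k) := by gcongr; omega
    have h10 : 0 ≤ (n + m + 1) * B := Nat.zero_le _
    have h11 : 1100 * (n + m + 1) * k = 1100 * ((n + m + 1) * k) := by ring
    have h12 : 2000 * (n + m + 1) * k = 2000 * ((n + m + 1) * k) := by ring
    have h13 : 1100 * (n + m + 1) * B = 1100 * ((n + m + 1) * B) := by ring
    have h14 : 2000 * (n + m + 1) * B = 2000 * ((n + m + 1) * B) := by ring
    omega

end Ecc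


/-! ### Averages over random words -/

/-- The average of `f` over the numbers below `N`. -/
noncomputable def avg (N : ℕ) (f : ℕ → ENNReal) : ENNReal := (N : ENNReal)⁻¹ * ∑ x ∈ Finset.range N, f x

/-- The average of `f` over the lists of `k` independent numbers below `N`. -/
noncomputable def iavg (N : ℕ) : ℕ → (List ℕ → ENNReal) → ENNReal
  | 0, f => f []
  | k + 1, f => avg N fun x => iavg N k fun l => f (x :: l)

section Avg

variable {N : ℕ}

theorem avg_const (hN : 0 < N) (c : ENNReal) : avg N (fun _ => c) = c := by
  simp only [avg, Finset.sum_const, Finset.card_range, nsmul_eq_mul]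
  rw [← mul_assoc, ENNReal.inv_mul_cancel (by simpa using hN.ne') (by simp), one_mul]

theorem avg_add (f g : ℕ → ENNReal) : avg N (fun x => f x + g x) = avg N f + avg N g := by
  simp [avg, Finset.sum_add_distrib, mul_add]

theorem avg_mul_left (c : ENNReal) (f : ℕ → ENNReal) :
    avg N (fun x => c * f x) = c * avg N f := by
  simp only [avg, ← Finset.mul_sum]
  rw [← mul_assoc, mul_comm _ c, mul_assoc]

theorem avg_sum {ι : Type*} (s : Finset ι) (f : ι → ℕ → ENNReal) :
    avg N (fun x => ∑ v ∈ s, f v x) = ∑ v ∈ s, avg N (f v) := by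
  simp only [avg, Finset.mul_sum]
  rw [Finset.sum_comm]

theorem iavg_const (hN : 0 < N) (k : ℕ) (c : ENNReal) : iavg N k (fun _ => c) = c := by
  induction k with
  | zero => rfl
  | succ k ih => simp [iavg, ih, avg_const hN]

theorem iavg_add (k : ℕ) (f g : List ℕ → ENNReal) :
    iavg N k (fun l => f l + g l) = iavg N k f + iavg N k g := by
  induction k generalizing f g with
  | zero => rfl
  | succ k ih => simp [iavg, ih, avg_add]

theorem iavg_mul_left (k : ℕ) (c : ENNReal) (f : List ℕ → ENNReal) :
    iavg N k (fun l => c * f l) = c * iavg N k f := by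
  induction k generalizing f with
  | zero => rfl
  | succ k ih => simp [iavg, ih, avg_mul_left]

theorem iavg_sum {ι : Type*} (s : Finset ι) (k : ℕ) (f : ι → List ℕ → ENNReal) :
    iavg N k (fun l => ∑ v ∈ s, f v l) = ∑ v ∈ s, iavg N k (f v) := by
  induction k generalizing f with
  | zero => rfl
  | succ k ih => simp [iavg, ih, avg_sum]

/-- The probability that independent samples all satisfy `p` is a power. -/
theorem iavg_forall (k : ℕ) (p : ℕ → Prop) [DecidablePred p] :
    iavg N k (fun l => if ∀ x ∈ l, p x then 1 else 0) =
      avg N (fun x => if p x then 1 else 0) ^ k := by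
  induction k with
  | zero => simp [iavg]
  | succ k ih =>
    have : ∀ x l, (if ∀ y ∈ x :: l, p y then (1 : ENNReal) else 0) =
        (if p x then 1 else 0) * if ∀ y ∈ l, p y then 1 else 0 := by
      intro x l
      by_cases hx : p x <;> simp [hx]
    simp only [iavg, this, iavg_mul_left, ih]
    simp only [mul_comm _ (avg N _ ^ k), avg_mul_left]
    rw [pow_succ]

/-- A random word, reduced modulo `n`, hits a set of vertices with at least half the probability
that a uniform vertex would have. -/
theorem avg_notMem_le {n : ℕ} (hn : 0 < n) (hnN : n ≤ N) {A : Finset ℕ}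
    (hA : A ⊆ Finset.range n) :
    avg N (fun x => if x % n ∉ A then 1 else 0) ≤
      ENNReal.ofReal (1 - (A.card : ℝ) / (2 * n)) := by
  have hN : 0 < N := hn.trans_le hnN
  set good := (Finset.range N).filter fun x => x % n ∈ A with hgood
  -- Every residue has at least `N / n` representatives below `N`.
  have hcount : A.card * (N / n) ≤ good.card := by
    rw [← Finset.card_range (N / n), ← Finset.card_product]
    refine Finset.card_le_card_of_injOn
      (fun p => n * p.2 + p.1) ?_ ?_
    · rintro ⟨a, j⟩ hp
      simp only [Finset.coe_product, Set.mem_prod, Finset.mem_coe, Finset.mem_range] at hp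
      have ha := Finset.mem_range.1 (hA hp.1)
      have h : n * j + a < N := by
        have : n * (j + 1) ≤ n * (N / n) := Nat.mul_le_mul_left _ hp.2
        have := Nat.mul_div_le N n
        rw [mul_add] at *; omega
      simp only [hgood, Finset.coe_filter, Finset.mem_range, Set.mem_ofPred_eq]
      rw [Nat.mul_add_mod, Nat.mod_eq_of_lt ha]
      exact ⟨h, hp.1⟩
    · rintro ⟨a, j⟩ hp ⟨a', j'⟩ hp' he
      simp only [Finset.coe_product, Set.mem_prod, Finset.mem_coe, Finset.mem_range] at hp hp'
      have ha := Finset.mem_range.1 (hA hp.1)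
      have ha' := Finset.mem_range.1 (hA hp'.1)
      have e1 : a = a' := by
        have := congrArg (· % n) he
        simpa [Nat.mul_add_mod, Nat.mod_eq_of_lt ha, Nat.mod_eq_of_lt ha'] using this
      subst e1
      have : n * j = n * j' := by simpa using he
      simp [Nat.eq_of_mul_eq_mul_left hn this]
  -- The quotient `N / n` is rounded down, which loses at most a factor of two since `n ≤ N`.
  have hfl : N ≤ 2 * n * (N / n) := by
    have h1 : 1 ≤ N / n := (Nat.one_le_div_iff hn).2 hnN
    have h2 := Nat.div_add_mod N n
    have h3 := Nat.mod_lt N hn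
    have h4 : n * 1 ≤ n * (N / n) := Nat.mul_le_mul_left _ h1
    have : 2 * n * (N / n) = n * (N / n) + n * (N / n) := by ring
    omega
  have hgN : good.card ≤ N := (Finset.card_filter_le _ _).trans (by simp)
  have hsum : ∑ x ∈ Finset.range N, (if x % n ∉ A then (1 : ENNReal) else 0) =
      ENNReal.ofReal (N - good.card) := by
    rw [Finset.sum_boole, Finset.filter_not, ← hgood, Finset.card_sdiff_of_subset (Finset.filter_subset _ _)]
    rw [← Nat.cast_sub (R := ℝ) hgN, ENNReal.ofReal_natCast]
    simp [hgood]
  rw [avg, hsum]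
  have hNr : (0 : ℝ) < N := by exact_mod_cast hN
  have hnr : (0 : ℝ) < n := by exact_mod_cast hn
  rw [← ENNReal.ofReal_natCast, ← ENNReal.ofReal_inv_of_pos hNr, ← ENNReal.ofReal_mul (by positivity)]
  refine ENNReal.ofReal_le_ofReal ?_
  have h1 : (A.card : ℝ) * ((N / n : ℕ) : ℝ) ≤ good.card := by exact_mod_cast hcount
  have h2 : (N : ℝ) ≤ 2 * n * ((N / n : ℕ) : ℝ) := by exact_mod_cast hfl
  have h3 : (A.card : ℝ) * N ≤ 2 * n * good.card := by
    calc (A.card : ℝ) * N ≤ A.card * (2 * n * ((N / n : ℕ) : ℝ)) := by gcongr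
      _ = 2 * n * (A.card * ((N / n : ℕ) : ℝ)) := by ring
      _ ≤ _ := by gcongr
  have h4 : (A.card : ℝ) / (2 * n) ≤ (N : ℝ)⁻¹ * good.card := by
    rw [div_le_iff₀ (by positivity), inv_mul_eq_div, div_mul_eq_mul_div, le_div_iff₀ hNr]
    linarith
  rw [mul_sub, inv_mul_cancel₀ hNr.ne']
  linarith

/-- A set of at least `r ≥ √n` vertices is missed by `4 * r * L` samples with probability at most
`1 / n ^ 2` if `n ≤ 2 ^ L`. -/
theorem iavg_miss_le {n : ℕ} (hn : 0 < n) (hnN : n ≤ N) {A : Finset ℕ}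
    (hA : A ⊆ Finset.range n) {r L : ℕ} (hr : n ≤ r * r) (hAr : r ≤ A.card) (hL : n ≤ 2 ^ L) :
    iavg N (4 * r * L) (fun l => if ∀ x ∈ l, x % n ∉ A then 1 else 0) ≤
      ((n : ENNReal) * n)⁻¹ := by
  rw [iavg_forall (4 * r * L) fun x => x % n ∉ A]
  have hnr : (0 : ℝ) < n := by exact_mod_cast hn
  have hAn : (A.card : ℝ) ≤ n := by
    have := Finset.card_le_card hA
    rw [Finset.card_range] at this
    exact_mod_cast this
  have hx : 0 ≤ 1 - (A.card : ℝ) / (2 * n) := by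
    rw [sub_nonneg, div_le_one (by positivity)]; linarith
  -- The exponent is chosen so that `(1 - r / (2 * n)) ^ (4 * r * L) ≤ exp (-2 * L)`.
  have hexp : (1 - (A.card : ℝ) / (2 * n)) ^ (4 * r * L) ≤ ((n : ℝ) * n)⁻¹ := by
    have h1 : 1 - (A.card : ℝ) / (2 * n) ≤ Real.exp (-(r / (2 * n))) := by
      have h := Real.add_one_le_exp (-((r : ℝ) / (2 * n)))
      have : (r : ℝ) / (2 * n) ≤ A.card / (2 * n) := by gcongr
      linarith
    have h2 : (2 * L : ℝ) ≤ (4 * r * L : ℕ) * (r / (2 * n)) := by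
      have : (n : ℝ) ≤ r * r := by exact_mod_cast hr
      rw [mul_div_assoc', le_div_iff₀ (by positivity)]
      push_cast
      have hL0 : (0 : ℝ) ≤ L := by positivity
      nlinarith
    have h3 : (n : ℝ) ≤ Real.exp L := by
      have h4 : (2 : ℝ) ≤ Real.exp 1 := by
        have := Real.add_one_le_exp 1
        linarith
      calc (n : ℝ) ≤ 2 ^ L := by exact_mod_cast hL
        _ ≤ Real.exp 1 ^ L := by gcongr
        _ = Real.exp L := by rw [← Real.exp_nat_mul, mul_one]
    calc _ ≤ Real.exp (-(r / (2 * n))) ^ (4 * r * L) := by gcongr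
      _ = Real.exp (-((4 * r * L : ℕ) * (r / (2 * n)))) := by rw [← Real.exp_nat_mul]; ring_nf
      _ ≤ Real.exp (-(2 * L)) := by gcongr
      _ = (Real.exp L * Real.exp L)⁻¹ := by rw [Real.exp_neg, ← Real.exp_add]; ring_nf
      _ ≤ _ := by gcongr
  calc _ ≤ ENNReal.ofReal (1 - (A.card : ℝ) / (2 * n)) ^ (4 * r * L) := by
        gcongr
        exact avg_notMem_le hn hnN hA
    _ = ENNReal.ofReal ((1 - (A.card : ℝ) / (2 * n)) ^ (4 * r * L)) := by
        rw [ENNReal.ofReal_pow hx]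
    _ ≤ ENNReal.ofReal (((n : ℝ) * n)⁻¹) := ENNReal.ofReal_le_ofReal hexp
    _ = _ := by
        rw [ENNReal.ofReal_inv_of_pos (by positivity), ENNReal.ofReal_mul hnr.le,
          ENNReal.ofReal_natCast]

end Avg


/-! ### The randomized program -/

/-- Starting with the command stack `K` in any machine state that represents `σ`, the machine is
a Las Vegas algorithm, and the expected clock reading at the end is at most `B`. -/
def Good (E : Env) (Correct : ℕ → Prop) (K : List Cmd) (σ : AState) (B : ENNReal) : Prop :=
  ∀ s, Rep E σ s → ∃ B', LasVegasFrom E.w Correct (K, s) B' ∧ σ.time + B' ≤ B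

/-- Choose the number `nLst = 4 * root * lg` of samples, where `root` is `√n` rounded up and `lg`
is the logarithm of `n`, rounded up and at least `1`. -/
def sampleSize : Stm :=
  .const .one 1 ;; .loop (.lt .pow .nVerts)
    (.op .add .root .root .one ;; .op .mul .pow .root .root) ;;
  .const .lg 1 ;; .const .pow 2 ;; .loop (.lt .pow .nVerts)
    (.op .add .pow .pow .pow ;; .op .add .lg .lg .one) ;;
  .op .mul .nLst .root .lg ;; .const .pow 4 ;; .op .mul .nLst .pow .nLst

/-- Turn the random word in `vertex` into a vertex and add it to the sample. -/
def addSample : Stm :=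
  .op .mod .vertex .vertex .nVerts ;; .write .src .pos .vertex ;; .write .lst .pos .vertex ;;
    .op .add .pos .pos .one

/-- Draw the sample. -/
def drawSample : Cmd :=
  .loop (.lt Var.pos.reg Var.nLst.reg) (.seq (.rand Var.vertex.reg) addSample.compile)

/-- Read the size of the graph and put the first address after the input into register `2`. -/
def setup : Cmd :=
  .seq (.const 1 1) <| .seq (.load Var.nArcs.reg 1) <| .seq (.load Var.nVerts.reg 0) <|
    .seq (.op .add 2 1 1) <| .seq (.op .add 2 2 Var.nArcs.reg) (.op .add 2 2 Var.nArcs.reg)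

/-- The diameter approximation. -/
def diamApprox : Cmd :=
  .seq setup <| .seq sampleSize.compile <| .seq drawSample <| .seq estimate.compile
    (.op .sub 0 Var.best.reg Var.one.reg)

section Good

variable {E : Env} {Correct : ℕ → Prop} {K : List Cmd} {σ : AState} {B : ENNReal}

theorem Good.mono {B' : ENNReal} (h : Good E Correct K σ B) (hB : B ≤ B') :
    Good E Correct K σ B' := fun s hs => by
  obtain ⟨B₁, h₁, h₂⟩ := h s hs
  exact ⟨B₁, h₁, h₂.trans hB⟩

theorem good_of_wp {p : Stm} (h : wp E p (fun σ' => Good E Correct K σ' B) σ) :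
    Good E Correct (p.compile :: K) σ B := fun s hs => by
  obtain ⟨t, s', σ', hst, hs', ht, hg⟩ := exists_steps_of_wp h hs K
  obtain ⟨B', h₁, h₂⟩ := hg s' hs'
  refine ⟨t + B', h₁.of_steps hst, le_trans ?_ h₂⟩
  rw [← add_assoc]
  gcongr
  exact_mod_cast ht

theorem good_seq {p q : Cmd} (h : Good E Correct (p :: q :: K) (σ.tick 1) B) :
    Good E Correct (.seq p q :: K) σ B := fun s hs => by
  obtain ⟨B', h₁, h₂⟩ := h s (hs.tick 1)
  refine ⟨1 + B', h₁.of_step_pure (by simp) rfl, le_trans ?_ h₂⟩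
  simp [add_assoc]

theorem good_loop {b : Test} {c : Cond} {p : Cmd} (hb : c.compile = b)
    (hpos : c.Holds σ → Good E Correct (p :: .loop b p :: K) (σ.tick 1) B)
    (hneg : ¬ c.Holds σ → Good E Correct K (σ.tick 1) B) :
    Good E Correct (.loop b p :: K) σ B := fun s hs => by
  subst hb
  have hc := Cond.compile_holds hs c
  by_cases h : c.Holds σ
  · obtain ⟨B', h₁, h₂⟩ := hpos h s (hs.tick 1)
    refine ⟨1 + B', h₁.of_step_pure (by simp) (by simp [step, hc, h]), le_trans ?_ h₂⟩
    simp [add_assoc]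
  · obtain ⟨B', h₁, h₂⟩ := hneg h s (hs.tick 1)
    refine ⟨1 + B', h₁.of_step_pure (by simp) (by simp [step, hc, h]), le_trans ?_ h₂⟩
    simp [add_assoc]

/-- A random draw averages the bounds for the possible outcomes. -/
theorem good_rand {d : Var} {B : ℕ → ENNReal}
    (h : ∀ x < 2 ^ E.w, Good E Correct K (σ.set d x 1) (B x)) :
    Good E Correct (.rand d.reg :: K) σ (avg (2 ^ E.w) B) := fun s hs => by
  have h' : ∀ x : Fin (2 ^ E.w), ∃ B', LasVegasFrom E.w Correct
      (K, s.setReg E.w d.reg x) B' ∧ (σ.time + 1 : ℕ) + B' ≤ B x := fun x =>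
    h x x.2 _ (hs.setVar d 1 x.2)
  choose B' h₁ h₂ using h'
  refine ⟨_, LasVegasFrom.of_step (c := (.rand d.reg :: K, s)) (by simp)
    (PMF.uniformOfFintype (Fin (2 ^ E.w))) (fun x => (K, s.setReg E.w d.reg (x : ℕ))) ?_ h₁, ?_⟩
  · rw [step]
    -- The random word is coerced to a natural number before it is written.
    change PMF.map _ ((PMF.uniformOfFintype _).bind (PMF.pure ∘ fun x : Fin (2 ^ E.w) => (x : ℕ))) = _
    rw [PMF.bind_pure_comp, PMF.map_comp]
    rfl
  have hN : 0 < 2 ^ E.w := by positivity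
  rw [← add_assoc]
  calc (σ.time : ENNReal) + 1 + ∑ x : Fin (2 ^ E.w),
        PMF.uniformOfFintype (Fin (2 ^ E.w)) x * B' x
      = avg (2 ^ E.w) (fun _ => (σ.time + 1 : ℕ)) +
          ((2 ^ E.w : ℕ) : ENNReal)⁻¹ * ∑ x : Fin (2 ^ E.w), B' x := by
        rw [avg_const hN, Finset.mul_sum]
        simp [PMF.uniformOfFintype_apply]
    _ = ((2 ^ E.w : ℕ) : ENNReal)⁻¹ * ∑ x : Fin (2 ^ E.w), ((σ.time + 1 : ℕ) + B' x) := by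
        rw [avg, ← mul_add, Finset.sum_add_distrib]
        congr 2
        rw [Fin.sum_univ_eq_sum_range (fun _ => ((σ.time + 1 : ℕ) : ENNReal))]
    _ ≤ ((2 ^ E.w : ℕ) : ENNReal)⁻¹ * ∑ x : Fin (2 ^ E.w), B x := by
        gcongr with x
        exact h₂ x
    _ = _ := by rw [avg, Fin.sum_univ_eq_sum_range]

variable {n m lim k T : ℕ}

/-- The state while the sample is drawn: the words `l` have been drawn, and the clock, which read `T`
at the beginning, has been charged for them. -/
structure Sampled (n m k T : ℕ) (l : List ℕ) (σ : AState) : Prop where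
  consts : HasConsts n m σ
  nLst : σ.v .nLst = k
  pos : σ.v .pos = l.length
  lst : ∀ (i : ℕ) (h : i < l.length), σ.a .lst i = l[i] % n
  src : ∀ (i : ℕ) (h : i < l.length), σ.a .src i = l[i] % n
  time : σ.time ≤ T + 60 * l.length

/-- If after drawing the words `l` the expected clock reading at the end is at most `F l`, then before
the draw it is at most the average of `F`. -/
theorem good_drawSample (hV : E.Valid n m lim) (hn : 0 < n) (hk : k ≤ lim) {F : List ℕ → ENNReal}
    (hK : ∀ l σ, l.length = k → Sampled n m k T l σ → Good E Correct K (σ.tick 1) (F l)) :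
    ∀ (j : ℕ) (l : List ℕ) (σ : AState), l.length + j = k → Sampled n m k T l σ →
      Good E Correct (drawSample :: K) σ (iavg (2 ^ E.w) j fun l' => F (l ++ l')) := by
  have hlim := hV.lim_lt
  have hnl := hV.n_le
  intro j
  induction j with
  | zero =>
    intro l σ hl hs
    refine good_loop (c := .lt .pos .nLst) rfl (fun h => ?_) fun _ => ?_
    · have : σ.v .pos < σ.v .nLst := h
      rw [hs.pos, hs.nLst] at this
      omega
    · simpa [iavg] using hK l σ hl hs
  | succ j ih =>
    intro l σ hl hs
    refine good_loop (c := .lt .pos .nLst) rfl (fun h => ?_) fun h => ?_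
    · refine good_seq (good_rand fun x _ => good_of_wp ?_)
      obtain ⟨⟨c1, c2, c3, c4⟩, h1, h2, h3, h4, h5⟩ := hs
      have hxn := Nat.mod_lt x hn
      simp only [addSample, wp, BinOp.eval, AState.tick_v, AState.set_v, AState.put_v, if_true,
        reduceCtorEq, if_false, c1, c3, h2]
      refine ⟨by omega, by omega, by omega, by omega, ?_⟩
      have := ih (l ++ [x]) ((((((((((σ.tick 1).tick 1).set .vertex x 1).tick 1).set .vertex
        (x % n) 1).tick 1).put .src l.length (x % n) 11).tick 1).put .lst l.length
        (x % n) 11).set .pos (l.length + 1) 1) (by simp; omega)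
        ⟨⟨by simpa using c1, by simpa using c2, by simpa using c3, by simpa using c4⟩,
          by simpa using h1, by simp, ?_, ?_, ?_⟩
      · simpa [drawSample, addSample] using this
      · intro i hi
        simp at hi
        rcases hi.lt_or_eq with hi | rfl
        · simp [Function.update_of_ne hi.ne, h3 i hi, List.getElem_append_left hi]
        · simp
      · intro i hi
        simp at hi
        rcases hi.lt_or_eq with hi | rfl
        · simp [Function.update_of_ne hi.ne, h4 i hi, List.getElem_append_left hi]
        · simp
      · simp; omega
    · exact absurd (show σ.v .pos < σ.v .nLst by rw [hs.pos, hs.nLst]; omega) h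

theorem wp_sampleSize {Q : AState → Prop} (hV : E.Valid n m lim) (hn : 0 < n)
    (hlim : 4 * n * n ≤ lim) (hv : ∀ x, σ.v x = if x = .nVerts then n else if x = .nArcs then m else 0)
    (hQ : ∀ σ' r L, 0 < r → 0 < L → (r - 1) * (r - 1) < n → n ≤ r * r → n ≤ 2 ^ L →
      L ≤ Nat.log 2 n + 1 → HasConsts n m σ' → σ'.v .nLst = 4 * r * L → σ'.v .pos = 0 →
      4 * r * L ≤ lim →
      σ'.time ≤ σ.time + 10 * (r + L) + 20 → Q σ') : wp E sampleSize Q σ := by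
  have hW := hV.lim_lt
  have h4n : 4 * n ≤ 4 * n * n := Nat.le_mul_of_pos_right _ hn
  have v1 : σ.v .nVerts = n := by simp [hv]
  have v2 : σ.v .nArcs = m := by simp [hv]
  have v3 : σ.v .zero = 0 := by simp [hv]
  have v4 : σ.v .pos = 0 := by simp [hv]
  have v5 : σ.v .pow = 0 := by simp [hv]
  have v6 : σ.v .root = 0 := by simp [hv]
  have key : ∀ r, (r - 1) * (r - 1) < n → r ≤ n := by
    intro r hr
    by_contra hlt
    have : n ≤ r - 1 := by omega
    have := Nat.mul_le_mul this this
    have := Nat.le_mul_of_pos_right n hn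
    omega
  refine ⟨by omega, ?_⟩
  refine ⟨fun k σ' => (HasConsts n m σ' ∧ σ'.v .pos = 0 ∧ σ'.v .pow = σ'.v .root * σ'.v .root ∧
    (σ'.v .root - 1) * (σ'.v .root - 1) < n ∧ σ'.time ≤ σ.time + 4 + 6 * σ'.v .root) ∧
    k = 6 * (n - σ'.v .root), _, ⟨⟨⟨?_, ?_, ?_, ?_⟩, ?_, ?_, ?_, ?_⟩, rfl⟩, ?_, ?_⟩
  · simpa using v1
  · simpa using v2
  · simp
  · simpa using v3
  · simpa using v4
  · simp [v5, v6]
  · simpa [v6] using hn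
  · simp; omega
  · rintro k σ' ⟨⟨⟨c1, c2, c3, c4⟩, hp, hpow, hr, ht⟩, rfl⟩ hlt
    simp only [Cond.Holds, c1, hpow] at hlt
    have hrn : σ'.v .root < n := by
      by_contra h
      push Not at h
      have := Nat.mul_le_mul h h
      have := Nat.le_mul_of_pos_right n hn
      omega
    have hsq : (σ'.v .root + 1) * (σ'.v .root + 1) ≤ n * n := Nat.mul_le_mul hrn hrn
    have h4 : 4 * n * n = 4 * (n * n) := by ring
    simp only [wp, BinOp.eval, AState.tick_v, AState.set_v, reduceCtorEq, if_true, c3]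
    refine ⟨by omega, by omega, _, ⟨⟨⟨?_, ?_, ?_, ?_⟩, ?_, ?_, ?_, ?_⟩, rfl⟩, ?_⟩
    · simpa using c1
    · simpa using c2
    · simpa using c3
    · simpa using c4
    · simpa using hp
    · simp
    · simpa using hlt
    · simp; omega
    · simp; omega
  rintro k₁ σ₁ ⟨⟨⟨c1, c2, c3, c4⟩, hp, hpow, hr, ht⟩, rfl⟩ hlt -
  simp only [Cond.Holds, c1, hpow, not_lt] at hlt
  set r := σ₁.v .root with hrdef
  have hrn := key r hr
  have hr0 : 0 < r := by
    rcases Nat.eq_zero_or_pos r with h | h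
    · rw [h] at hlt; omega
    · exact h
  refine ⟨by omega, by omega, ?_⟩
  refine ⟨fun k σ' => (HasConsts n m σ' ∧ σ'.v .pos = 0 ∧ σ'.v .root = r ∧ 0 < σ'.v .lg ∧
    σ'.v .pow = 2 ^ σ'.v .lg ∧ σ'.v .lg ≤ Nat.log 2 n + 1 ∧
    σ'.time ≤ σ₁.time + 10 + 6 * σ'.v .lg) ∧
    k = 6 * (Nat.log 2 n + 1 - σ'.v .lg), _,
    ⟨⟨⟨?_, ?_, ?_, ?_⟩, ?_, ?_, ?_, ?_, ?_, ?_⟩, rfl⟩, ?_, ?_⟩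
  · simpa using c1
  · simpa using c2
  · simpa using c3
  · simpa using c4
  · simpa using hp
  · simp [hrdef]
  · simp
  · simp
  · simp
  · simp
  · rintro k σ' ⟨⟨⟨c1, c2, c3, c4⟩, hp, hrr, hl, hpow, hle, ht⟩, rfl⟩ hlt
    simp only [Cond.Holds, c1, hpow] at hlt
    have hlog := Nat.le_log_of_pow_le Nat.one_lt_two hlt.le
    have hlogn := Nat.log_lt_self 2 hn.ne'
    simp only [wp, BinOp.eval, AState.tick_v, AState.set_v, reduceCtorEq, if_false, c3, hpow]
    refine ⟨by omega, by omega, _, ⟨⟨⟨?_, ?_, ?_, ?_⟩, ?_, ?_, ?_, ?_, ?_, ?_⟩, rfl⟩, ?_⟩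
    · simpa using c1
    · simpa using c2
    · simpa using c3
    · simpa using c4
    · simpa using hp
    · simpa using hrr
    · simp
    · simp [pow_succ, mul_two]
    · simpa using hlog
    · simp; omega
    · simp; omega
  rintro k₂ σ₂ ⟨⟨⟨c1, c2, c3, c4⟩, hp, hrr, hl, hpow, hle, ht₂⟩, rfl⟩ hlt₂ -
  simp only [Cond.Holds, c1, hpow, not_lt] at hlt₂
  set L := σ₂.v .lg with hLdef
  have hLn : L ≤ n := hle.trans (Nat.log_lt_self 2 hn.ne')
  have hrL : r * L ≤ n * n := Nat.mul_le_mul hrn hLn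
  have h4 : 4 * n * n = 4 * (n * n) := by ring
  have h5 : 4 * r * L = 4 * (r * L) := by ring
  simp only [wp, BinOp.eval, AState.tick_v, AState.set_v, reduceCtorEq, if_true, if_false, hrr,
    ← hLdef]
  refine ⟨by omega, by omega, by omega, hQ _ r L hr0 hl hr hlt hlt₂ hle ⟨?_, ?_, ?_, ?_⟩ ?_ ?_ ?_ ?_⟩
  · simpa using c1
  · simpa using c2
  · simpa using c3
  · simpa using c4
  · simp [mul_assoc]
  · simpa using hp
  · omega
  · simp; omega

end Good


/-! ### Distances in graphs -/

section Walks

variable {V : Type*} {G : Digraph V}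

theorem HasWalk.append {j k : ℕ} {u x v : V} (h₁ : HasWalk G j u x) (h₂ : HasWalk G k x v) :
    HasWalk G (j + k) u v := by
  induction j generalizing u with
  | zero => cases h₁; simpa using h₂
  | succ j ih =>
    obtain ⟨y, hy, h⟩ := h₁
    rw [Nat.add_right_comm]
    exact ⟨y, hy, ih h⟩

theorem HasWalk.split {j k : ℕ} {u v : V} (h : HasWalk G (j + k) u v) :
    ∃ x, HasWalk G j u x ∧ HasWalk G k x v := by
  induction j generalizing u with
  | zero => exact ⟨u, rfl, by simpa using h⟩
  | succ j ih =>
    rw [Nat.add_right_comm] at h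
    obtain ⟨y, hy, h⟩ := h
    obtain ⟨x, h₁, h₂⟩ := ih h
    exact ⟨x, ⟨y, hy, h₁⟩, h₂⟩

theorem hasWalk_one {u v : V} : HasWalk G 1 u v ↔ G.Adj u v := by
  simp [HasWalk]

theorem edist_le_of_hasWalk {k : ℕ} {u v : V} (h : HasWalk G k u v) : edist G u v ≤ k :=
  iInf₂_le k h

theorem hasWalk_toNat_edist {u v : V} (h : edist G u v ≠ ⊤) :
    HasWalk G (edist G u v).toNat u v := by
  classical
  have hex : ∃ k, HasWalk G k u v := by
    by_contra hne
    push Not at hne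
    exact h (by simp [edist, hne])
  have heq : edist G u v = (Nat.find hex : ℕ) := by
    refine le_antisymm (edist_le_of_hasWalk (Nat.find_spec hex)) ?_
    refine le_iInf₂ fun k hk => ?_
    exact_mod_cast Nat.find_min' hex hk
  rw [heq]
  exact Nat.find_spec hex

end Walks

/-- `D` is the distance of the graph with vertices `v < n` and arcs `a < m` from `tl a` to `hd a`,
all distances being finite. The conditions are local: they mention one arc at a time. -/
structure IsGraphDist (n m : ℕ) (tl hd : ℕ → ℕ) (D : ℕ → ℕ → ℕ) : Prop where
  eq_zero_iff : ∀ u < n, ∀ v < n, D u v = 0 ↔ u = v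
  le_succ : ∀ u < n, ∀ a < m, D u (hd a) ≤ D u (tl a) + 1
  pred : ∀ u < n, ∀ v < n, ∀ k, D u v = k + 1 → ∃ a < m, hd a = v ∧ D u (tl a) = k

/-- The distance from the set `S`; it is `0` if `S` is empty. -/
noncomputable def setDist (D : ℕ → ℕ → ℕ) (S : ℕ → Prop) (v : ℕ) : ℕ :=
  sInf {d | ∃ s, S s ∧ D s v = d}

theorem setDist_le {D : ℕ → ℕ → ℕ} {S : ℕ → Prop} {s : ℕ} (hs : S s) (v : ℕ) :
    setDist D S v ≤ D s v := Nat.sInf_le ⟨s, hs, rfl⟩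

theorem exists_setDist_eq (D : ℕ → ℕ → ℕ) {S : ℕ → Prop} (hS : ∃ s, S s) (v : ℕ) :
    ∃ s, S s ∧ D s v = setDist D S v := by
  obtain ⟨s, hs⟩ := hS
  exact Nat.sInf_mem (s := {d | ∃ s, S s ∧ D s v = d}) ⟨D s v, s, hs, rfl⟩

/-- The distance from a set is what breadth-first search from that set computes. -/
theorem IsGraphDist.isDistFrom {n m : ℕ} {tl hd : ℕ → ℕ} {D : ℕ → ℕ → ℕ}
    (h : IsGraphDist n m tl hd D) {S : ℕ → Prop} (hS : ∃ s, S s)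
    (hSn : ∀ s, S s → s < n) : IsDistFrom n m tl hd S (setDist D S) where
  eq_zero_iff v hv := by
    obtain ⟨s, hs, he⟩ := exists_setDist_eq D hS v
    constructor
    · intro h0
      rw [h0] at he
      exact (h.eq_zero_iff s (hSn s hs) v hv).1 he ▸ hs
    · intro hv'
      have := setDist_le (D := D) hv' v
      rw [(h.eq_zero_iff v hv v hv).2 rfl] at this
      omega
  le_succ a ha := by
    obtain ⟨s, hs, he⟩ := exists_setDist_eq D hS (tl a)
    rw [← he]
    exact (setDist_le hs _).trans (h.le_succ s (hSn s hs) a ha)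
  pred v hv k hk := by
    obtain ⟨s, hs, he⟩ := exists_setDist_eq D hS v
    rw [hk] at he
    obtain ⟨a, ha, hav, hak⟩ := h.pred s (hSn s hs) v hv k he
    refine ⟨a, ha, hav, le_antisymm (hak ▸ setDist_le hs _) ?_⟩
    obtain ⟨s', hs', he'⟩ := exists_setDist_eq D hS (tl a)
    have h1 := h.le_succ s' (hSn s' hs') a ha
    have h2 := setDist_le (D := D) hs' v
    rw [hav] at h1
    omega

theorem IsGraphDist.isDistFrom_single {n m : ℕ} {tl hd : ℕ → ℕ} {D : ℕ → ℕ → ℕ}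
    (h : IsGraphDist n m tl hd D) {s : ℕ} (hs : s < n) :
    IsDistFrom n m tl hd (fun v => v = s) (D s) := by
  have := h.isDistFrom (S := fun v => v = s) ⟨s, rfl⟩ (by rintro _ rfl; exact hs)
  have he : setDist D (fun v => v = s) = D s := by
    ext v
    obtain ⟨s', rfl, he⟩ := exists_setDist_eq D (S := fun v => v = s) ⟨s, rfl⟩ v
    exact he.symm
  rwa [he] at this

/-- In a strongly connected graph all vertices but one are heads of arcs. -/
theorem IsGraphDist.card_le {n m : ℕ} {tl hd : ℕ → ℕ} {D : ℕ → ℕ → ℕ}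
    (h : IsGraphDist n m tl hd D) (hn : 0 < n) : n ≤ m + 1 := by
  have hsub : (Finset.range n).erase 0 ⊆ (Finset.range m).image hd := by
    intro v hv
    obtain ⟨hv0, hvn⟩ := Finset.mem_erase.1 hv
    rw [Finset.mem_range] at hvn
    have h0 : D 0 v ≠ 0 := fun h0 => hv0 ((h.eq_zero_iff 0 hn v hvn).1 h0).symm
    obtain ⟨a, ha, hav, -⟩ := h.pred 0 hn v hvn (D 0 v - 1) (by omega)
    exact Finset.mem_image.2 ⟨a, Finset.mem_range.2 ha, hav⟩
  have := (Finset.card_le_card hsub).trans Finset.card_image_le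
  rw [Finset.card_erase_of_mem (Finset.mem_range.2 hn), Finset.card_range, Finset.card_range] at this
  omega

/-- The properties of distances that the approximation guarantee depends on. -/
structure IsGeodesic (n : ℕ) (D : ℕ → ℕ → ℕ) : Prop where
  triangle : ∀ u < n, ∀ x < n, ∀ v < n, D u v ≤ D u x + D x v
  split : ∀ u < n, ∀ v < n, ∀ j k, D u v = j + k → ∃ x < n, D u x = j ∧ D x v = k

section Digraph

variable {n : ℕ} (G : Digraph (Fin n))

/-- The distance of two vertices, which are given as numbers; it is `0` for numbers that are not
vertices, and for vertices at infinite distance. -/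
noncomputable def natDist (u v : ℕ) : ℕ :=
  if h : u < n ∧ v < n then (edist G ⟨u, h.1⟩ ⟨v, h.2⟩).toNat else 0

variable {G} {l : List (Fin n × Fin n)} {tl hd : ℕ → ℕ}

theorem natDist_of_lt {u v : ℕ} (hu : u < n) (hv : v < n) :
    natDist G u v = (edist G ⟨u, hu⟩ ⟨v, hv⟩).toNat := dif_pos ⟨hu, hv⟩

theorem natDist_le {u v k : ℕ} (hu : u < n) (hv : v < n) (h : HasWalk G k ⟨u, hu⟩ ⟨v, hv⟩) :
    natDist G u v ≤ k := by
  rw [natDist_of_lt hu hv]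
  exact ENat.toNat_le_of_le_natCast (edist_le_of_hasWalk h)

theorem hasWalk_natDist (hfin : ∀ u v, edist G u v ≠ ⊤) {u v : ℕ} (hu : u < n) (hv : v < n) :
    HasWalk G (natDist G u v) ⟨u, hu⟩ ⟨v, hv⟩ := by
  rw [natDist_of_lt hu hv]
  exact hasWalk_toNat_edist (hfin _ _)

theorem isGeodesic_natDist (hfin : ∀ u v, edist G u v ≠ ⊤) : IsGeodesic n (natDist G) := by
  have tri : ∀ u < n, ∀ x < n, ∀ v < n, natDist G u v ≤ natDist G u x + natDist G x v :=
    fun u hu x hx v hv =>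
      natDist_le hu hv ((hasWalk_natDist hfin hu hx).append (hasWalk_natDist hfin hx hv))
  refine ⟨tri, fun u hu v hv j k hjk => ?_⟩
  have hw := hasWalk_natDist hfin hu hv
  rw [hjk] at hw
  obtain ⟨x, h1, h2⟩ := hw.split
  have h1' := natDist_le hu x.2 h1
  have h2' := natDist_le x.2 hv h2
  have := tri u hu x x.2 v hv
  exact ⟨x, x.2, by omega, by omega⟩

/-- Distances satisfy the local conditions both in the graph and in the reversed graph. -/
theorem isGraphDist_natDist (hfin : ∀ u v, edist G u v ≠ ⊤) (hl : IsArcList G.Adj l)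
    (harc : ∀ (a : ℕ) (h : a < l.length), tl a = l[a].1 ∧ hd a = l[a].2) :
    IsGraphDist n l.length tl hd (natDist G) ∧
      IsGraphDist n l.length hd tl (fun u v => natDist G v u) := by
  have hgeo := isGeodesic_natDist hfin
  have hz : ∀ u < n, ∀ v < n, natDist G u v = 0 ↔ u = v := by
    intro u hu v hv
    constructor
    · intro h
      have := hasWalk_natDist hfin hu hv
      rw [h] at this
      exact congrArg Fin.val (show (⟨u, hu⟩ : Fin n) = ⟨v, hv⟩ from this)
    · rintro rfl
      exact Nat.le_zero.1 (natDist_le hu hu rfl)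
  have harc1 : ∀ a < l.length, tl a < n ∧ hd a < n ∧ natDist G (tl a) (hd a) ≤ 1 := by
    intro a ha
    obtain ⟨h1, h2⟩ := harc a ha
    refine ⟨by rw [h1]; exact l[a].1.2, by rw [h2]; exact l[a].2.2, ?_⟩
    rw [h1, h2]
    exact natDist_le l[a].1.2 l[a].2.2
      (hasWalk_one.2 ((hl.2 l[a].1 l[a].2).1 (List.getElem_mem ha)))
  have hadj : ∀ u < n, ∀ v < n, natDist G u v = 1 → ∃ a < l.length, tl a = u ∧ hd a = v := by
    intro u hu v hv h
    have hw := hasWalk_natDist hfin hu hv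
    rw [h, hasWalk_one, ← hl.2] at hw
    obtain ⟨a, ha, he⟩ := List.getElem_of_mem hw
    obtain ⟨h1, h2⟩ := harc a ha
    exact ⟨a, ha, by rw [h1, he], by rw [h2, he]⟩
  refine ⟨⟨hz, ?_, ?_⟩, ⟨fun u hu v hv => (hz v hv u hu).trans eq_comm, ?_, ?_⟩⟩
  · intro u hu a ha
    obtain ⟨h1, h2, h3⟩ := harc1 a ha
    have := hgeo.triangle u hu _ h1 _ h2
    omega
  · intro u hu v hv k hk
    obtain ⟨x, hx, h1, h2⟩ := hgeo.split u hu v hv k 1 hk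
    obtain ⟨a, ha, hax, hav⟩ := hadj x hx v hv h2
    exact ⟨a, ha, hav, by rw [hax, h1]⟩
  · intro u hu a ha
    obtain ⟨h1, h2, h3⟩ := harc1 a ha
    have := hgeo.triangle _ h1 _ h2 u hu
    show natDist G (tl a) u ≤ natDist G (hd a) u + 1
    omega
  · intro u hu v hv k hk
    obtain ⟨x, hx, h1, h2⟩ := hgeo.split v hv u hu 1 k (by rw [hk, add_comm])
    obtain ⟨a, ha, hav, hax⟩ := hadj v hv x hx h1
    exact ⟨a, ha, hav, by rw [hax, h2]⟩

/-- A finite diameter is attained. -/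
theorem ediam_spec (hn : 0 < n) {Δ : ℕ} (h : ediam G = Δ) : (∀ u v, edist G u v ≠ ⊤) ∧
    (∀ u < n, ∀ v < n, natDist G u v ≤ Δ) ∧ ∃ u < n, ∃ v < n, natDist G u v = Δ := by
  have hle : ∀ u v, edist G u v ≤ Δ := fun u v => h ▸ le_iSup₂ (f := fun u v => edist G u v) u v
  refine ⟨fun u v hT => ?_, fun u hu v hv => ?_, ?_⟩
  · have := hle u v
    rw [hT] at this
    simp at this
  · rw [natDist_of_lt hu hv]
    exact ENat.toNat_le_of_le_natCast (hle _ _)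
  · have : Nonempty (Fin n) := ⟨⟨0, hn⟩⟩
    obtain ⟨u, hu⟩ := exists_eq_ciSup_of_finite (f := fun u => ⨆ v, edist G u v)
    obtain ⟨v, hv⟩ := exists_eq_ciSup_of_finite (f := fun v => edist G u v)
    refine ⟨u, u.2, v, v.2, ?_⟩
    have : edist G u v = Δ := by rw [hv, hu]; exact h
    rw [natDist_of_lt u.2 v.2, this, ENat.toNat_natCast]

end Digraph

/-! ### The approximation guarantee -/

/-- Let `a`, `b` be at distance `3 * h + z`. If `c` is at distance at most `h` from the sample,
then so is `a`, and some sample is far from `b`. Otherwise the vertices at distance at most `h` from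
`c` are searched backwards, and one of them lies on a shortest path from `c` to `b`: it is far from
`a` unless `b` is far from `c`. -/
theorem goodEstimate_of_searches {n h z c best : ℕ} {D : ℕ → ℕ → ℕ} {S : ℕ → Prop}
    (hD : IsGeodesic n D) (hS : ∃ s, S s) (hSn : ∀ s, S s → s < n)
    (hdiam : ∃ u < n, ∃ v < n, D u v = 3 * h + z) (hc : c < n)
    (hmax : ∀ v < n, setDist (fun u v => D v u) S v ≤ setDist (fun u v => D v u) S c)
    (hle : best ≤ 3 * h + z + 1) (h₁ : ∀ s, S s → ∀ v < n, D s v + 1 ≤ best)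
    (h₂ : ∀ v < n, D c v + 1 ≤ best)
    (h₃ : ∀ x < n, D c x < setDist (fun u v => D v u) S c → ∀ v < n, D v x + 1 ≤ best) :
    GoodEstimate h z (best - 1) := by
  obtain ⟨a, ha, b, hb, hab⟩ := hdiam
  -- This is the weaker one of the two bounds: `2 * h + z` if `z ≤ 1`, and `2 * h + 1` if `z = 2`.
  suffices H : 2 * h + min z 1 + 1 ≤ best by
    refine ⟨by omega, fun hz => by omega, fun hz => by omega⟩
  by_cases hr : setDist (fun u v => D v u) S c ≤ h
  · obtain ⟨s, hs, he⟩ := exists_setDist_eq (fun u v => D v u) hS a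
    have he' : D a s ≤ h := by
      have := hmax a ha
      have : D a s = _ := he
      omega
    have := hD.triangle a ha s (hSn s hs) b hb
    have := h₁ s hs b hb
    omega
  · push Not at hr
    by_cases hfar : 2 * h + z ≤ D c b
    · have := h₂ b hb
      omega
    · push Not at hfar
      obtain ⟨x, hx, h4, h5⟩ := hD.split c hc b hb (min h (D c b)) (D c b - min h (D c b))
        (by omega)
      have := h₃ x hx (by omega) a ha
      have := hD.triangle a ha x hx b hb
      omega

/-- If a ball around a vertex has at least `r` elements, it contains the smallest such ball. -/
theorem exists_smallest_ball {n r : ℕ} (hr : r ≤ n) (D : ℕ → ℕ → ℕ) (v : ℕ) :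
    ∃ A ⊆ Finset.range n, r ≤ A.card ∧ ∀ t,
      r ≤ ((Finset.range n).filter fun x => D v x < t).card →
        A ⊆ (Finset.range n).filter fun x => D v x < t := by
  by_cases h : ∃ t, r ≤ ((Finset.range n).filter fun x => D v x < t).card
  · refine ⟨_, Finset.filter_subset _ _, Nat.find_spec h, fun t ht x hx => ?_⟩
    rw [Finset.mem_filter] at hx ⊢
    exact ⟨hx.1, hx.2.trans_le (Nat.find_min' h ht)⟩
  -- If no ball is that large, the condition on `A` is void.
  · push Not at h
    exact ⟨Finset.range n, subset_rfl, by simpa using hr, fun t ht => absurd ht (h t).not_ge⟩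


/-! ### Correctness and expected running time -/

section Main

variable {E : Env} {Correct : ℕ → Prop} {n m lim k T r L h z : ℕ} {D : ℕ → ℕ → ℕ}

/-- The sample that is given by the words `l`. -/
def sampleSet (n : ℕ) (l : List ℕ) (v : ℕ) : Prop := ∃ x ∈ l, x % n = v

theorem good_finish {σ : AState} (hone : σ.v .one = 1) (h : Correct (σ.v .best - 1)) :
    Good E Correct [.op .sub 0 Var.best.reg Var.one.reg] σ (σ.time + 1) := fun s hs => by
  refine ⟨1 + 0, (LasVegasFrom.halted ?_ 0).of_step_pure (by simp) rfl, by simp⟩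
  have hlt : σ.v .best - 1 < 2 ^ E.w := by
    have := hs.reg_lt Var.best.reg
    rw [hs.var] at this
    omega
  simpa [State.setReg, BinOp.eval, hs.var, hone, Nat.mod_eq_of_lt hlt] using h

/-- The number of the sets `A v`, for vertices `v`, that the sample `l` misses. -/
noncomputable def missCount (n : ℕ) (A : ℕ → Finset ℕ) (l : List ℕ) : ENNReal :=
  ∑ v ∈ Finset.range n, if ∀ x ∈ l, x % n ∉ A v then 1 else 0

/-- The open ball around `c` that just fails to reach the sample is small, unless the sample
misses the smallest ball with `r` elements around some vertex. -/
theorem card_ball_le {A : ℕ → Finset ℕ} {l : List ℕ} {c : ℕ} (hc : c < n)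
    (hA : ∀ t, r ≤ ((Finset.range n).filter fun x => D c x < t).card →
      A c ⊆ (Finset.range n).filter fun x => D c x < t) :
    (((Finset.range n).filter fun x =>
      D c x < setDist (fun u v => D v u) (sampleSet n l) c).card : ENNReal) ≤
        r + n * missCount n A l := by
  by_cases hr : r ≤ ((Finset.range n).filter fun x =>
      D c x < setDist (fun u v => D v u) (sampleSet n l) c).card
  · have hmiss : ∀ x ∈ l, x % n ∉ A c := by
      intro x hx hxA
      have := (Finset.mem_filter.1 (hA _ hr hxA)).2
      have h' : setDist (fun u v => D v u) (sampleSet n l) c ≤ D c (x % n) :=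
        setDist_le (D := fun u v => D v u) (S := sampleSet n l) ⟨x, hx, rfl⟩ c
      omega
    have h1 : 1 ≤ missCount n A l := by
      have := Finset.single_le_sum (f := fun v =>
        if ∀ x ∈ l, x % n ∉ A v then (1 : ENNReal) else 0) (fun _ _ => zero_le)
        (Finset.mem_range.2 hc)
      rwa [if_pos hmiss] at this
    calc _ ≤ (n : ENNReal) := by
          exact_mod_cast (Finset.card_filter_le _ _).trans (Finset.card_range n).le
      _ = n * 1 := (mul_one _).symm
      _ ≤ n * missCount n A l := by gcongr
      _ ≤ _ := le_add_self
  · push Not at hr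
    exact le_add_right (by exact_mod_cast hr.le)

/-- On average, the failures of the sample add a constant to the size of the ball, although
each one is charged with all `n` vertices. -/
theorem iavg_missCount_le {N : ℕ} (hn : 0 < n) (hnN : n ≤ N) {A : ℕ → Finset ℕ}
    (hA : ∀ v, A v ⊆ Finset.range n) (hAr : ∀ v, r ≤ (A v).card) (hr : n ≤ r * r)
    (hL : n ≤ 2 ^ L) : n * iavg N (4 * r * L) (missCount n A) ≤ 1 := by
  have h0 : (n : ENNReal) ≠ 0 := by simpa using hn.ne'
  unfold missCount
  rw [iavg_sum]
  calc _ ≤ (n : ENNReal) * ∑ v ∈ Finset.range n, ((n : ENNReal) * n)⁻¹ := by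
        gcongr with v
        exact iavg_miss_le hn hnN (hA v) hr (hAr v) hL
    _ = 1 := by
        rw [Finset.sum_const, Finset.card_range, nsmul_eq_mul, ← mul_assoc]
        exact ENNReal.mul_inv_cancel (by simp [h0]) (by finiteness)

/-- The running time once the sample has been drawn; it is random only through `missCount`. -/
theorem good_estimate (hV : E.Valid n m lim) (hn : 0 < n) (hk0 : 0 < k) (hk : k ≤ lim)
    (hD : IsGeodesic n D) (hout : IsGraphDist n m (E.arcEnd 0) (E.arcEnd 1) D)
    (hin : IsGraphDist n m (E.arcEnd 1) (E.arcEnd 0) fun u v => D v u)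
    (hle : ∀ u < n, ∀ v < n, D u v ≤ 3 * h + z)
    (hdiam : ∃ u < n, ∃ v < n, D u v = 3 * h + z) {A : ℕ → Finset ℕ}
    (hA : ∀ v t, r ≤ ((Finset.range n).filter fun x => D v x < t).card →
      A v ⊆ (Finset.range n).filter fun x => D v x < t)
    {l : List ℕ} (hl : l.length = k) {σ : AState} (hs : Sampled n m k T l σ) :
    Good E (GoodEstimate h z)
      [.seq estimate.compile (.op .sub 0 Var.best.reg Var.one.reg)] (σ.tick 1)
      ((T + 60 * k + 3 + 2000 * (n + m + 1) * (k + r + 1) : ℕ) +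
        (2000 * (n + m + 1) : ℕ) * (n * missCount n A l)) := by
  obtain ⟨hc, h1, h2, h3, h4, h5⟩ := hs
  have hSn : ∀ s, sampleSet n l s → s < n := by
    rintro _ ⟨x, -, rfl⟩
    exact Nat.mod_lt x hn
  have hS : ∃ s, sampleSet n l s :=
    ⟨l[0] % n, l[0], List.getElem_mem (by omega), rfl⟩
  have hset : (fun v => ∃ i < k, σ.a .lst i = v) = sampleSet n l := by
    ext v
    constructor
    · rintro ⟨i, hi, rfl⟩
      exact ⟨l[i], List.getElem_mem _, (h3 i (by omega)).symm⟩
    · rintro ⟨x, hx, rfl⟩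
      obtain ⟨i, hi, rfl⟩ := List.getElem_of_mem hx
      exact ⟨i, by omega, h3 i hi⟩
  refine good_seq (good_of_wp (wp_estimate (Δ := 3 * h + z) (D := D)
    (dS := setDist (fun u v => D v u) (sampleSet n l)) hV ⟨hc.1, hc.2, hc.3, hc.4⟩ hn ?_ ?_ ?_
    (fun s hs => hout.isDistFrom_single hs) (fun s hs => hin.isDistFrom_single hs) ?_ hle ?_))
  · intro i hi
    simp only [AState.tick_v, h1] at hi
    simp only [AState.tick_a, h3 i (by omega)]
    exact Nat.mod_lt _ hn
  · simpa [h1] using hk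
  · intro i hi
    simp only [AState.tick_v, h1] at hi
    simp only [AState.tick_a, h3 i (by omega), h4 i (by omega)]
  · simp only [AState.tick_v, AState.tick_a, h1, hset]
    exact hin.isDistFrom hS hSn
  · intro σ' c hc' hcn hmax hb hb₁ hb₂ hb₃ ht
    simp only [AState.tick_v, AState.tick_a, AState.tick_time, h1] at hb₁ ht
    refine (good_finish hc'.one ?_).mono ?_
    · refine goodEstimate_of_searches hD hS hSn hdiam hcn hmax hb ?_ hb₂ hb₃
      intro s hs v hv
      rw [← hset] at hs
      obtain ⟨i, hi, rfl⟩ := hs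
      exact hb₁ i hi v hv
    · have hball := card_ball_le (l := l) hcn (hA c)
      set β := ((Finset.range n).filter fun x =>
        D c x < setDist (fun u v => D v u) (sampleSet n l) c).card
      have ht' : σ'.time + 1 ≤ T + 60 * k + 3 + 2000 * (n + m + 1) * (k + 1) +
          2000 * (n + m + 1) * β := by
        have : 2000 * (n + m + 1) * (k + β + 1) =
          2000 * (n + m + 1) * (k + 1) + 2000 * (n + m + 1) * β := by ring
        rw [hl] at h5
        omega
      calc ((σ'.time : ENNReal) + 1) ≤ ((T + 60 * k + 3 + 2000 * (n + m + 1) * (k + 1) : ℕ) +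
            (2000 * (n + m + 1) : ℕ) * (β : ENNReal)) := by exact_mod_cast ht'
        _ ≤ ((T + 60 * k + 3 + 2000 * (n + m + 1) * (k + 1) : ℕ) +
            (2000 * (n + m + 1) : ℕ) * (r + n * missCount n A l)) := by gcongr
        _ = _ := by push_cast; ring

/-- The expected running time of the algorithm after the input has been read. -/
theorem good_main (hV : E.Valid n m lim) (hn : 0 < n) (hlim : 4 * n * n ≤ lim)
    (hD : IsGeodesic n D) (hout : IsGraphDist n m (E.arcEnd 0) (E.arcEnd 1) D)
    (hin : IsGraphDist n m (E.arcEnd 1) (E.arcEnd 0) fun u v => D v u)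
    (hle : ∀ u < n, ∀ v < n, D u v ≤ 3 * h + z)
    (hdiam : ∃ u < n, ∃ v < n, D u v = 3 * h + z) {σ : AState} (ht : σ.time ≤ 20)
    (hv : ∀ x, σ.v x = if x = .nVerts then n else if x = .nArcs then m else 0) :
    Good E (GoodEstimate h z) [.seq sampleSize.compile <| .seq drawSample <|
      .seq estimate.compile (.op .sub 0 Var.best.reg Var.one.reg)] σ
      (100000 * (m + 1) * (n.sqrt + 1) * (Nat.log 2 n + 1) : ℕ) := by
  refine good_seq (good_of_wp (wp_sampleSize hV hn hlim (fun x => by simpa using hv x) ?_))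
  intro σ₁ r L hr0 hL0 hr1 hr2 hL1 hL2 hc hk hpos hkl ht₁
  have hrn : r ≤ n := by
    by_contra hlt
    have h1 : n ≤ r - 1 := by omega
    have := Nat.mul_le_mul h1 h1
    have := Nat.le_mul_of_pos_right n hn
    omega
  choose A hA₁ hA₂ hA₃ using exists_smallest_ball hrn D
  have hk0 : 0 < 4 * r * L := by positivity
  have hdraw := good_drawSample (T := σ₁.time + 1) hV hn hkl
    (fun l σ hl hs => good_estimate hV hn hk0 hkl hD hout hin hle hdiam hA₃ hl hs)
    (4 * r * L) [] (σ₁.tick 1) (by simp)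
    ⟨⟨hc.1, hc.2, hc.3, hc.4⟩, by simpa using hk, by simpa using hpos, by simp, by simp, by simp⟩
  refine good_seq (hdraw.mono ?_)
  have hN : 0 < 2 ^ E.w := by positivity
  have hnN : n ≤ 2 ^ E.w := by
    have := hV.lim_lt
    have := hV.n_le
    omega
  simp only [List.nil_append]
  rw [iavg_add, iavg_const hN, iavg_mul_left, iavg_mul_left]
  set k := 4 * r * L with hkdef
  have hnm := hout.card_le hn
  have hr3 : r ≤ n.sqrt + 1 := by
    have : r - 1 ≤ n.sqrt := Nat.le_sqrt.2 hr1.le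
    omega
  have hrL : r ≤ r * L := Nat.le_mul_of_pos_right r hL0
  have hLr : L ≤ r * L := Nat.le_mul_of_pos_left L hr0
  have hk4 : k = 4 * (r * L) := by rw [hkdef]; ring
  -- The main term is `(n + m) * k` with `n ≤ m + 1` and `k = 4 * r * L`.
  have hbig : σ₁.time + 1 + 60 * k + 3 + 2000 * (n + m + 1) * (k + r + 1) + 2000 * (n + m + 1) ≤
      100000 * (m + 1) * (n.sqrt + 1) * (Nat.log 2 n + 1) := by
    have h1 : 2000 * (n + m + 1) * (k + r + 1) + 2000 * (n + m + 1) ≤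
        2000 * (2 * (m + 1)) * (7 * (r * L)) := by
      calc _ = 2000 * (n + m + 1) * (k + r + 2) := by ring
        _ ≤ _ := Nat.mul_le_mul (Nat.mul_le_mul_left _ (by omega)) (by omega)
    have h2 : σ₁.time + 1 + 60 * k + 3 ≤ 340 * (r * L) := by
      simp only [AState.tick_time] at ht₁
      omega
    have h3 : 340 * (r * L) ≤ 340 * ((m + 1) * (r * L)) :=
      Nat.mul_le_mul_left _ (Nat.le_mul_of_pos_left _ (by omega))
    have h4 : 100000 * (m + 1) * (r * L) ≤
        100000 * (m + 1) * (n.sqrt + 1) * (Nat.log 2 n + 1) := by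
      rw [mul_assoc _ (n.sqrt + 1)]
      exact Nat.mul_le_mul_left _ (Nat.mul_le_mul hr3 hL2)
    have h5 : 2000 * (2 * (m + 1)) * (7 * (r * L)) = 28000 * ((m + 1) * (r * L)) := by ring
    have h6 : 100000 * (m + 1) * (r * L) = 100000 * ((m + 1) * (r * L)) := by ring
    linarith
  calc _ ≤ ((σ₁.time + 1 + 60 * k + 3 + 2000 * (n + m + 1) * (k + r + 1) : ℕ) : ENNReal) +
        (2000 * (n + m + 1) : ℕ) * 1 := by
        gcongr
        exact iavg_missCount_le hn hnN hA₁ hA₂ hr2 hL1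
    _ ≤ _ := by
        rw [mul_one]
        exact_mod_cast hbig

end Main

/-- The environment of an input. -/
def inputEnv {n : ℕ} (w : ℕ) (l : List (Fin n × Fin n)) : Env :=
  ⟨w, 2 * l.length + 2, (inputState l).mem⟩

/-- The values of the variables and arrays after the input has been read. -/
def initialAState (n m : ℕ) : AState where
  v x := if x = .nVerts then n else if x = .nArcs then m else 0
  a _ _ := 0
  time := 12

theorem inputEnv_arcEnd {n w : ℕ} {l : List (Fin n × Fin n)} (a : ℕ) (h : a < l.length) :
    (inputEnv w l).arcEnd 0 a = l[a].1 ∧ (inputEnv w l).arcEnd 1 a = l[a].2 := by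
  have h1 : (2 * a + (2 + 0) - 2) / 2 = a := by omega
  have h2 : (2 * a + (2 + 1) - 2) / 2 = a := by omega
  have h3 : (2 * a + (2 + 1)) % 2 ≠ 0 := by omega
  constructor
  · simp [Env.arcEnd, inputEnv, inputState, h]
  · simp only [Env.arcEnd, inputEnv, inputState, h2, List.getElem?_eq_getElem h, h3, if_false]
    rw [if_neg (by omega), if_neg (by omega)]

/-- Reading the size of the graph establishes the representation of variables and arrays. -/
theorem setup_steps {n w : ℕ} (l : List (Fin n × Fin n)) (rest : Cmd)
    (hw : n + 2 * l.length + 2 < 2 ^ w) : ∃ s, Rep (inputEnv w l) (initialAState n l.length) s ∧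
      Steps w 12 ([.seq setup rest], inputState l) ([rest], s) := by
  have e1 : 1 % 2 ^ w = 1 := Nat.mod_eq_of_lt (by omega)
  have e2 : l.length % 2 ^ w = l.length := Nat.mod_eq_of_lt (by omega)
  have e3 : n % 2 ^ w = n := Nat.mod_eq_of_lt (by omega)
  have e4 : (1 + 1) % 2 ^ w = 2 := Nat.mod_eq_of_lt (by omega)
  have e5 : (2 + l.length) % 2 ^ w = 2 + l.length := Nat.mod_eq_of_lt (by omega)
  have e6 : (2 + l.length + l.length) % 2 ^ w = 2 + l.length + l.length :=
    Nat.mod_eq_of_lt (by omega)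
  have m0 : (inputState l).mem 0 = n := rfl
  have m1 : (inputState l).mem 1 = l.length := rfl
  have r0 : ∀ i, (inputState l).reg i = 0 := fun _ => rfl
  have hlen : ∀ a, 2 * l.length + 2 ≤ a → (inputState l).mem a = 0 := by
    intro a ha
    have : l.length ≤ (a - 2) / 2 := by omega
    simp only [inputState, List.getElem?_eq_none this]
    rw [if_neg (by omega), if_neg (by omega)]
  have hmem : ∀ a, (inputState l).mem a < 2 ^ w := by
    intro a
    simp only [inputState]
    split_ifs with h1 h2 h3
    · omega
    · omega
    · split
      · omega
      · next e _ => have := e.1.2; omega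
    · split
      · omega
      · next e _ => have := e.2.2; omega
  refine ⟨_, ?_, .head rfl <| .head rfl <| .head rfl <| .head rfl <| .head rfl <| .head rfl <|
    .head rfl <| .head rfl <| .head rfl <| .head rfl <| .head rfl <| .head rfl rfl⟩
  have ne1 : ∀ x : Var, x.reg ≠ 1 := fun x => x.reg_ne.1
  have ne2 : ∀ x : Var, x.reg ≠ 2 := fun x => x.reg_ne.2.1
  have ne0 : ∀ x : Var, x.reg ≠ 0 := fun x => x.reg_ne.2.2.2
  have hinj : ∀ x y : Var, x.reg = y.reg ↔ x = y := fun x y =>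
    ⟨fun h => Var.ctorIdx_injective (Nat.add_right_cancel h), congrArg _⟩
  refine ⟨?_, ?_, ?_, ?_, ?_, ?_⟩
  · simp [State.setReg, BinOp.eval, ne2, (ne1 _).symm, (ne0 _).symm, hinj, m0, m1, r0, e1, e2, e3,
      e4, e5, e6, inputEnv]
    omega
  · intro x
    simp [State.setReg, BinOp.eval, Function.update_apply, ne1, ne2, (ne1 _).symm, (ne0 _).symm,
      hinj, m0, m1, r0, e1, e2, e3, e4, e5, e6, initialAState]
  · intro A i
    exact hlen _ (by simp only [inputEnv]; omega)
  · intro x _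
    rfl
  · intro r
    simp only [State.setReg, Function.update_apply]
    split_ifs <;> first | exact Nat.mod_lt _ (by positivity) | (rw [r0]; positivity)
  · exact hmem

/-- All addresses fit into a word: the input takes at most `2 * n ^ 2 + 2` cells, and array indices,
which count eightfold, go up to `4 * n ^ 2`. -/
theorem memory_lt {n w : ℕ} (hw : 10 * (Nat.log 2 n + 1) ≤ w) :
    34 * (n * n) + 18 < 2 ^ w := by
  have h1 : n + 1 ≤ 2 ^ (Nat.log 2 n + 1) := Nat.lt_pow_succ_log_self Nat.one_lt_two n
  have h2 : 2 ≤ 2 ^ (Nat.log 2 n + 1) := by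
    rw [pow_succ]
    have : 1 ≤ 2 ^ Nat.log 2 n := Nat.one_le_two_pow
    omega
  set p := 2 ^ (Nat.log 2 n + 1)
  calc 34 * (n * n) + 18 < 256 * ((n + 1) * (n + 1)) := by nlinarith
    _ = 2 ^ 8 * ((n + 1) * (n + 1)) := by norm_num
    _ ≤ p ^ 8 * (p * p) := by gcongr
    _ = 2 ^ ((Nat.log 2 n + 1) * 10) := by rw [pow_mul]; ring
    _ ≤ 2 ^ w := Nat.pow_le_pow_right (by norm_num) (by omega)

/-- The bound on the expected running time in real numbers. -/
theorem time_le (n m : ℕ) (hn : 0 < n) :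
    ((100000 * (m + 1) * (n.sqrt + 1) * (Nat.log 2 n + 1) : ℕ) : ℝ) ≤
      600000 * (((m : ℝ) + 1) * Real.sqrt n * Real.log ((n : ℝ) + 1)) := by
  have hn1 : (1 : ℝ) ≤ n := by exact_mod_cast hn
  have h1 : ((n.sqrt : ℝ) + 1) ≤ 2 * Real.sqrt n := by
    have : (n.sqrt : ℝ) ≤ Real.sqrt n := Real.nat_sqrt_le_real_sqrt
    have : 1 ≤ Real.sqrt n := Real.one_le_sqrt.2 hn1
    linarith
  have h2 : ((Nat.log 2 n : ℝ) + 1) ≤ 3 * Real.log (n + 1) := by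
    have hlog2 := Real.log_two_gt_d9
    have hp : ((2 : ℝ) ^ (Nat.log 2 n + 1)) ≤ (n + 1) ^ 2 := by
      have : (2 : ℝ) ^ Nat.log 2 n ≤ n := by exact_mod_cast Nat.pow_log_le_self 2 hn.ne'
      rw [pow_succ]
      nlinarith
    have := Real.log_le_log (by positivity) hp
    rw [Real.log_pow, Real.log_pow] at this
    push_cast at this
    have h0 : 0 ≤ (Nat.log 2 n : ℝ) + 1 := by positivity
    nlinarith
  push_cast
  calc (100000 * ((m : ℝ) + 1) * (n.sqrt + 1) * (Nat.log 2 n + 1)) ≤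
        100000 * ((m : ℝ) + 1) * (2 * Real.sqrt n) * (3 * Real.log (n + 1)) := by gcongr
    _ = _ := by ring

/-- The guarantee for directed graphs. -/
theorem isLasVegas_diamApprox {n : ℕ} (G : Digraph (Fin n)) (l : List (Fin n × Fin n))
    (h z w : ℕ) (hn : 0 < n) (hl : IsArcList G.Adj l) (hd : ediam G = ((3 * h + z : ℕ) : ℕ∞))
    (hw : 10 * (Nat.log 2 n + 1) ≤ w) :
    IsLasVegas w diamApprox (inputState l) (GoodEstimate h z)
      (600000 * (((l.length : ℝ) + 1) * Real.sqrt n * Real.log ((n : ℝ) + 1))) := by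
  obtain ⟨hfin, hle, hdiam⟩ := ediam_spec hn hd
  obtain ⟨hout, hin⟩ := isGraphDist_natDist (l := l) hfin hl fun a h => inputEnv_arcEnd (w := w) a h
  have hm : l.length ≤ n * n := by simpa using hl.1.length_le_card
  have hW := memory_lt hw
  have hnn : n ≤ n * n := Nat.le_mul_of_pos_left n hn
  have hV : (inputEnv w l).Valid n l.length (4 * (n * n)) := by
    refine ⟨rfl, by omega, by omega, ?_, ?_⟩
    · show 2 * l.length + 2 + 8 * (4 * (n * n)) + 16 < 2 ^ w
      omega
    · intro a ha o ho
      obtain ⟨h1, h2⟩ := inputEnv_arcEnd (w := w) a ha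
      interval_cases o
      · rw [h1]; exact l[a].1.2
      · rw [h2]; exact l[a].2.2
  obtain ⟨s, hs, hsteps⟩ := setup_steps (w := w) l (.seq sampleSize.compile <| .seq drawSample <|
      .seq estimate.compile (.op .sub 0 Var.best.reg Var.one.reg)) (by omega)
  obtain ⟨B, hB, hBle⟩ := good_main hV hn (by rw [mul_assoc]) (isGeodesic_natDist hfin) hout hin
    hle hdiam (σ := initialAState n l.length) (by simp [initialAState]) (fun _ => rfl) s hs
  obtain ⟨hcorrect, htime⟩ := hB.of_steps hsteps
  refine ⟨fun t c hc => hcorrect t c (by rwa [run_eq_runFrom] at hc), ?_⟩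
  simp only [expectedTime, run_eq_runFrom]
  refine (htime.trans hBle).trans ?_
  rw [← ENNReal.ofReal_natCast]
  exact ENNReal.ofReal_le_ofReal (time_le n l.length hn)


/-! ### Undirected graphs -/

section Undirected

variable {V : Type*} (G : SimpleGraph V)

theorem hasWalk_iff_exists_walk (k : ℕ) (u v : V) :
    HasWalk ⟨G.Adj⟩ k u v ↔ ∃ p : G.Walk u v, p.length = k := by
  constructor
  · intro h
    induction k generalizing u with
    | zero => cases h; exact ⟨.nil, rfl⟩
    | succ k ih =>
      obtain ⟨x, hx, h⟩ := h
      obtain ⟨p, hp⟩ := ih x h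
      exact ⟨.cons hx p, by simp [hp]⟩
  · rintro ⟨p, rfl⟩
    induction p with
    | nil => rfl
    | cons hx p ih => exact ⟨_, hx, ih⟩

theorem ediam_mk_adj : ediam ⟨G.Adj⟩ = G.ediam := by
  have h : ∀ u v, edist ⟨G.Adj⟩ u v = G.edist u v := by
    intro u v
    simp only [edist, SimpleGraph.edist, hasWalk_iff_exists_walk]
    refine le_antisymm (le_iInf fun p => iInf₂_le p.length ⟨p, rfl⟩) ?_
    refine le_iInf₂ ?_
    rintro k ⟨p, rfl⟩
    exact iInf_le _ p
  simp only [ediam, h, SimpleGraph.ediam, SimpleGraph.eccent]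

/-- Every edge is listed at most twice. -/
theorem length_le_two_mul_ncard {n : ℕ} (G : SimpleGraph (Fin n)) {l : List (Fin n × Fin n)}
    (hl : IsArcList G.Adj l) : l.length ≤ 2 * G.edgeSet.ncard := by
  classical
  rw [← List.toFinset_card_of_nodup hl.1, ← SimpleGraph.coe_edgeFinset, Set.ncard_coe_finset]
  refine Finset.card_le_mul_card_image_of_maps_to (f := fun e : Fin n × Fin n => s(e.1, e.2)) ?_ 2 ?_
  · rintro ⟨u, v⟩ he
    simpa using (hl.2 u v).1 (by simpa using he)
  · intro e _
    induction e with
    | h u v =>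
    refine (Finset.card_le_card (t := {(u, v), (v, u)}) ?_).trans Finset.card_le_two
    rintro ⟨a, b⟩ hab
    have := (Finset.mem_filter.1 hab).2
    simp at this ⊢
    exact this

end Undirected

end DiamApprox

theorem mainTheorem3 :
    ∃ (P : DiamApprox.Cmd) (c k : ℕ) (C : ℝ),
      -- directed graphs with `n` vertices and `m = l.length` arcs
      (∀ (n : ℕ) (G : Digraph (Fin n)) (l : List (Fin n × Fin n)) (h z w : ℕ),
        0 < n → DiamApprox.IsArcList G.Adj l →
        z ∈ ({0, 1, 2} : Set ℕ) → DiamApprox.ediam G = ((3 * h + z : ℕ) : ℕ∞) →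
        c * (Nat.log 2 n + 1) ≤ w →
        DiamApprox.IsLasVegas w P (DiamApprox.inputState l) (DiamApprox.GoodEstimate h z)
          (C * (((l.length : ℝ) + 1) * Real.sqrt n * Real.log ((n : ℝ) + 1) ^ k))) ∧
      -- undirected graphs with `n` vertices and `m = G.edgeSet.ncard` edges
      (∀ (n : ℕ) (G : SimpleGraph (Fin n)) (l : List (Fin n × Fin n)) (h z w : ℕ),
        0 < n → DiamApprox.IsArcList G.Adj l →
        z ∈ ({0, 1, 2} : Set ℕ) → G.ediam = ((3 * h + z : ℕ) : ℕ∞) →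
        c * (Nat.log 2 n + 1) ≤ w →
        DiamApprox.IsLasVegas w P (DiamApprox.inputState l) (DiamApprox.GoodEstimate h z)
          (C * (((G.edgeSet.ncard : ℝ) + 1) * Real.sqrt n * Real.log ((n : ℝ) + 1) ^ k))) := by
  refine ⟨DiamApprox.diamApprox, 10, 1, 1200000, ?_, ?_⟩
  · intro n G l h z w hn hl _ hd hw
    obtain ⟨h1, h2⟩ := DiamApprox.isLasVegas_diamApprox G l h z w hn hl hd hw
    refine ⟨h1, h2.trans (ENNReal.ofReal_le_ofReal ?_)⟩
    have hlog : 0 ≤ Real.log ((n : ℝ) + 1) := Real.log_nonneg (by simp)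
    rw [pow_one]
    gcongr
    norm_num
  · intro n G l h z w hn hl _ hd hw
    obtain ⟨h1, h2⟩ := DiamApprox.isLasVegas_diamApprox ⟨G.Adj⟩ l h z w hn hl
      (by rw [DiamApprox.ediam_mk_adj, hd]) hw
    refine ⟨h1, h2.trans (ENNReal.ofReal_le_ofReal ?_)⟩
    have hlog : 0 ≤ Real.log ((n : ℝ) + 1) := Real.log_nonneg (by simp)
    have hm : (l.length : ℝ) ≤ 2 * G.edgeSet.ncard := by
      exact_mod_cast DiamApprox.length_le_two_mul_ncard G hl
    calc 600000 * (((l.length : ℝ) + 1) * Real.sqrt n * Real.log ((n : ℝ) + 1)) ≤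
          600000 * ((2 * ((G.edgeSet.ncard : ℝ) + 1)) * Real.sqrt n * Real.log ((n : ℝ) + 1)) := by
          gcongr
          linarith
      _ = _ := by ring
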